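/- Let $n\ge 2$ and $\alpha>0$. Let $S^n\subset\mathbb R^{n+1}$ be the unit sphere with surface measure $dy$, and write its points off the poles as $x=(\theta,\xi')=(\sin\theta\,\xi',-\cos\theta)$ with $0<\theta<\pi$, $\xi'\in S^{n-1}$ (so $\tan(\theta/2)\,\xi'$ is the stereographic projection of $x$ that sends $-e_{n+1}$ to $0$). Put $\sigma_{n-1}=2\pi^{n/2}/\Gamma(n/2)$ and, for measurable $\varphi:S^n\to\mathbb C$, $$(S^\alpha_+\varphi)(x)=\frac{2}{\Gamma(\alpha)\sigma_{n-1}}\int_{-1<y_{n+1}<x_{n+1}}\frac{(x_{n+1}-y_{n+1})^\alpha}{|x-y|^n}\varphi(y)\,dy,$$ $$(S^\alpha_-\varphi)(x)=\frac{2}{\Gamma(\alpha)\sigma_{n-1}}\int_{x_{n+1}<y_{n+1}<1}\frac{(y_{n+1}-x_{n+1})^\alpha}{|x-y|^n}\varphi(y)\,dy .$$ Let $\{Y_{j,k}: j\ge 0,\ 1\le k\le d_n(j)\}$ be an orthonormal basis of $L^2(S^{n-1})$ consisting of real spherical harmonics, where $Y_{j,k}$ has degree $j$ and $d_n(j)$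 is the dimension of the space of spherical harmonics of degree $j$. For a function $g$ on $S^{n-1}$, the relation $g\sim\sum_{j,k}c_{j,k}Y_{j,k}$ means that $g\in L^1(S^{n-1})$ and $c_{j,k}=\int_{S^{n-1}}g\,Y_{j,k}\,d\xi'$ for all $j,k$. **Theorem.** Suppose that $\varphi(\theta,\cdot)\sim\sum_{j,k}\varphi_{j,k}(r)\,Y_{j,k}$, $r=\tan(\theta/2)$, for almost every $\theta\in(0,\pi)$. Let $f^\pm=S^\alpha_\pm\varphi$, and put $$f^+_{j,k}(r)=c_\alpha(r)\int_0^r(r^2-\rho^2)^{\alpha-1}\frac{\varphi_{j,k}(\rho)}{(1+\rho^2)^{\alpha+n/2}}\Big(\frac{\rho}{r}\Big)^{j+n-2}\rho\,d\rho,$$ $$f^-_{j,k}(r)=c_\alpha(r)\int_r^\infty(\rho^2-r^2)^{\alpha-1}\frac{\varphi_{j,k}(\rho)}{(1+\rho^2)^{\alpha+n/2}}\Big(\frac{r}{\rho}\Big)^{j}\rho\,d\rho,\qquad c_\alpha(r)=\frac{2^{\alpha+1}}{\Gamma(\alpha)}(1+r^2)^{n/2-\alpha}.$$ For each choice of the sign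 $\pm$: (i) if the integral $(S^\alpha_\pm\varphi)(x)$ exists in the Lebesgue sense for almost every $x\in S^n$, then for almost every $\theta\in(0,\pi)$ all the integrals $f^\pm_{j,k}(\tan(\theta/2))$ converge absolutely and $$f^\pm(\theta,\cdot)\sim\sum_{j,k}f^\pm_{j,k}(\tan(\theta/2))\,Y_{j,k};$$ (ii) the same conclusion holds at every individual $\theta\in(0,\pi)$ for which $\int_{S^{n-1}}(S^\alpha_\pm|\varphi|)(\theta,\xi')\,d\xi'<\infty$. -/

import Mathlib

open MeasureTheory Set

noncomputable section

/-- The unit sphere of the Euclidean space `ℝ^m` (so `USphere n` is `S^{n-1}` and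
`USphere (n + 1)` is `S^n`). -/
abbrev USphere (m : ℕ) : Type := Metric.sphere (0 : EuclideanSpace ℝ (Fin m)) 1

/-- The (unnormalized) surface area measure on the unit sphere of `ℝ^m`. -/
def surf (m : ℕ) : Measure (USphere m) :=
  (volume : Measure (EuclideanSpace ℝ (Fin m))).toSphere

/-- The last coordinate `x_{n+1}` of a point `x` of `S^n`. -/
def lastCoord {n : ℕ} (x : USphere (n + 1)) : ℝ :=
  (x : EuclideanSpace ℝ (Fin (n + 1))) (Fin.last n)

/-- The area `σ_{n-1} = 2 π^{n/2} / Γ(n/2)` of the unit sphere `S^{n-1}` in `ℝ^n`. -/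
def sphereArea (n : ℕ) : ℝ := 2 * Real.pi ^ ((n : ℝ) / 2) / Real.Gamma ((n : ℝ) / 2)

/-- The vector `(sin θ · ξ', - cos θ)` of `ℝ^{n+1}`. -/
def polarVec {n : ℕ} (θ : ℝ) (ξ : USphere n) : EuclideanSpace ℝ (Fin (n + 1)) :=
  WithLp.toLp 2
    (Fin.snoc (α := fun _ => ℝ)
      (fun i : Fin n => Real.sin θ * (ξ : EuclideanSpace ℝ (Fin n)) i) (-Real.cos θ))

theorem norm_polarVec {n : ℕ} (θ : ℝ) (ξ : USphere n) : ‖polarVec θ ξ‖ = 1 := by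
  have hξ : ∑ i, ((ξ : EuclideanSpace ℝ (Fin n)) i) ^ 2 = 1 := by
    have h := EuclideanSpace.norm_sq_eq (ξ : EuclideanSpace ℝ (Fin n))
    have h1 : ‖(ξ : EuclideanSpace ℝ (Fin n))‖ = 1 := by simp
    rw [h1] at h
    simpa using h.symm
  have h2 : ‖polarVec θ ξ‖ ^ 2 = 1 := by
    rw [EuclideanSpace.norm_sq_eq, Fin.sum_univ_castSucc]
    simp only [polarVec, Fin.snoc_castSucc, Fin.snoc_last, Real.norm_eq_abs, sq_abs, mul_pow]
    rw [← Finset.mul_sum, hξ]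
    linarith [Real.sin_sq_add_cos_sq θ]
  nlinarith [norm_nonneg (polarVec θ ξ)]

/-- The point of `S^n` with polar coordinates `(θ, ξ')`, where `0 < θ < π`, `ξ' ∈ S^{n-1}`. The
angle is measured from the south pole `-e_{n+1}`, so that the stereographic projection that sends
`-e_{n+1}` to `0` and `e_{n+1}` to `∞` sends this point to `tan (θ / 2) · ξ'`. -/
def polarPt {n : ℕ} (θ : ℝ) (ξ : USphere n) : USphere (n + 1) :=
  ⟨polarVec θ ξ, by simpa using norm_polarVec θ ξ⟩

theorem lastCoord_polarPt {n : ℕ} (θ : ℝ) (ξ : USphere n) :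
    lastCoord (polarPt θ ξ) = -Real.cos θ := by
  simp [lastCoord, polarPt, polarVec]

/-- The spherical segment `{y ∈ S^n : a < y_{n+1} < b}`. -/
def segment_S (n : ℕ) (a b : ℝ) : Set (USphere (n + 1)) :=
  {y | a < lastCoord y ∧ lastCoord y < b}

/-- The kernel of the left-sided spherical fractional integral,
`(x_{n+1} - y_{n+1})^α / |x - y|^n`. -/
def kerLeft (n : ℕ) (α : ℝ) (x y : USphere (n + 1)) : ℝ :=
  (lastCoord x - lastCoord y) ^ α /
    ‖(x : EuclideanSpace ℝ (Fin (n + 1))) - (y : EuclideanSpace ℝ (Fin (n + 1)))‖ ^ n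

/-- The kernel of the right-sided spherical fractional integral,
`(y_{n+1} - x_{n+1})^α / |x - y|^n`. -/
def kerRight (n : ℕ) (α : ℝ) (x y : USphere (n + 1)) : ℝ :=
  (lastCoord y - lastCoord x) ^ α /
    ‖(x : EuclideanSpace ℝ (Fin (n + 1))) - (y : EuclideanSpace ℝ (Fin (n + 1)))‖ ^ n

/-- The left-sided spherical fractional integral `S^α_{a+} φ`. -/
def sphFracLeft (n : ℕ) (α a : ℝ) (φ : USphere (n + 1) → ℂ) (x : USphere (n + 1)) : ℂ :=
  ((2 / (Real.Gamma α * sphereArea n) : ℝ) : ℂ) *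
    ∫ y in segment_S n a (lastCoord x), (kerLeft n α x y : ℂ) * φ y ∂(surf (n + 1))

/-- The right-sided spherical fractional integral `S^α_{b-} φ`. -/
def sphFracRight (n : ℕ) (α b : ℝ) (φ : USphere (n + 1) → ℂ) (x : USphere (n + 1)) : ℂ :=
  ((2 / (Real.Gamma α * sphereArea n) : ℝ) : ℂ) *
    ∫ y in segment_S n (lastCoord x) b, (kerRight n α x y : ℂ) * φ y ∂(surf (n + 1))

/-- `S^α_+ = S^α_{(-1)+}`. -/
def SPlus (n : ℕ) (α : ℝ) (φ : USphere (n + 1) → ℂ) (x : USphere (n + 1)) : ℂ :=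
  sphFracLeft n α (-1) φ x

/-- `S^α_- = S^α_{1-}`. -/
def SMinus (n : ℕ) (α : ℝ) (φ : USphere (n + 1) → ℂ) (x : USphere (n + 1)) : ℂ :=
  sphFracRight n α 1 φ x

/-- The integral defining `(S^α_+ φ)(x)` exists in the Lebesgue sense. -/
def SPlusExists (n : ℕ) (α : ℝ) (φ : USphere (n + 1) → ℂ) (x : USphere (n + 1)) : Prop :=
  IntegrableOn (fun y => (kerLeft n α x y : ℂ) * φ y) (segment_S n (-1) (lastCoord x))
    (surf (n + 1))

/-- The integral defining `(S^α_- φ)(x)` exists in the Lebesgue sense. -/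
def SMinusExists (n : ℕ) (α : ℝ) (φ : USphere (n + 1) → ℂ) (x : USphere (n + 1)) : Prop :=
  IntegrableOn (fun y => (kerRight n α x y : ℂ) * φ y) (segment_S n (lastCoord x) 1)
    (surf (n + 1))

/-- At the angle `θ`, the integral over `ξ' ∈ S^{n-1}` of `(S^α_+ |φ|)(θ, ξ')` is finite. -/
def SPlusFiniteAt (n : ℕ) (α : ℝ) (φ : USphere (n + 1) → ℂ) (θ : ℝ) : Prop :=
  ∫⁻ ξ : USphere n, (∫⁻ y in segment_S n (-1) (lastCoord (polarPt θ ξ)),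
    ‖(kerLeft n α (polarPt θ ξ) y : ℂ) * φ y‖ₑ ∂(surf (n + 1))) ∂(surf n) < ⊤

/-- At the angle `θ`, the integral over `ξ' ∈ S^{n-1}` of `(S^α_- |φ|)(θ, ξ')` is finite. -/
def SMinusFiniteAt (n : ℕ) (α : ℝ) (φ : USphere (n + 1) → ℂ) (θ : ℝ) : Prop :=
  ∫⁻ ξ : USphere n, (∫⁻ y in segment_S n (lastCoord (polarPt θ ξ)) 1,
    ‖(kerRight n α (polarPt θ ξ) y : ℂ) * φ y‖ₑ ∂(surf (n + 1))) ∂(surf n) < ⊤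

/-- The Laplacian of a polynomial in `n` variables, as a linear map. -/
def polyLaplacian (n : ℕ) : MvPolynomial (Fin n) ℝ →ₗ[ℝ] MvPolynomial (Fin n) ℝ :=
  ∑ i : Fin n, ((MvPolynomial.pderiv i).toLinearMap ∘ₗ (MvPolynomial.pderiv i).toLinearMap)

/-- Restriction of a polynomial to the unit sphere `S^{n-1}`, as a linear map. -/
def restrictSphere (n : ℕ) : MvPolynomial (Fin n) ℝ →ₗ[ℝ] (USphere n → ℝ) where
  toFun p := fun ξ => MvPolynomial.eval (fun i => (ξ : EuclideanSpace ℝ (Fin n)) i) p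
  map_add' p q := by ext ξ; simp
  map_smul' c p := by ext ξ; simp [MvPolynomial.smul_eval]

/-- The space of (real) spherical harmonics of degree `j` on `S^{n-1}`: the restrictions of the
harmonic homogeneous polynomials of degree `j`. -/
def sphHarm (n j : ℕ) : Submodule ℝ (USphere n → ℝ) :=
  (MvPolynomial.homogeneousSubmodule (Fin n) ℝ j ⊓ LinearMap.ker (polyLaplacian n)).map
    (restrictSphere n)

/-- The dimension `d_n(j)` of the space of spherical harmonics of degree `j` on `S^{n-1}`. -/
def sphHarmDim (n j : ℕ) : ℕ := Module.finrank ℝ (sphHarm n j)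

/-- `{Y_{j,k}}`, `j ≥ 0`, `1 ≤ k ≤ d_n(j)`, is an orthonormal basis of `L²(S^{n-1})` consisting of
spherical harmonics, `Y_{j,k}` being of degree `j`. (For each `j` there are as many functions as the
dimension of the space of spherical harmonics of degree `j`, so that they span it.) -/
structure IsSphHarmBasis (n : ℕ) (Y : (j : ℕ) → Fin (sphHarmDim n j) → USphere n → ℝ) : Prop where
  mem : ∀ j k, Y j k ∈ sphHarm n j
  orthonormal : ∀ (i : ℕ) (l : Fin (sphHarmDim n i)) (j : ℕ) (k : Fin (sphHarmDim n j)),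
    ∫ ξ, Y i l ξ * Y j k ξ ∂(surf n) =
      if (⟨i, l⟩ : Σ j, Fin (sphHarmDim n j)) = ⟨j, k⟩ then 1 else 0

/-- `g ∼ ∑_{j,k} c_{j,k} Y_{j,k}` is the Fourier-Laplace decomposition of `g` on `S^{n-1}`:
`g` is integrable and `c_{j,k} = ∫ g Y_{j,k}` for all `j`, `k`. -/
def IsFourierLaplace (n : ℕ) (Y : (j : ℕ) → Fin (sphHarmDim n j) → USphere n → ℝ)
    (g : USphere n → ℂ) (c : (j : ℕ) → Fin (sphHarmDim n j) → ℂ) : Prop :=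
  Integrable g (surf n) ∧ ∀ j k, c j k = ∫ ξ, g ξ * (Y j k ξ : ℂ) ∂(surf n)

/-- `c_α(r) = 2^{α+1} / Γ(α) · (1 + r²)^{n/2 - α}`. -/
def cAlpha (n : ℕ) (α r : ℝ) : ℝ :=
  2 ^ (α + 1) / Real.Gamma α * (1 + r ^ 2) ^ ((n : ℝ) / 2 - α)

/-- The integrand of `f^+_{j,k}(r)`, with `u = φ_{j,k}`. -/
def abelPlusIntegrand (n : ℕ) (α : ℝ) (j : ℕ) (u : ℝ → ℂ) (r ρ : ℝ) : ℂ :=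
  (((r ^ 2 - ρ ^ 2) ^ (α - 1) : ℝ) : ℂ) * (u ρ / (((1 + ρ ^ 2) ^ (α + (n : ℝ) / 2) : ℝ) : ℂ)) *
    (((ρ / r) ^ (j + n - 2) * ρ : ℝ) : ℂ)

/-- The integrand of `f^-_{j,k}(r)`, with `u = φ_{j,k}`. -/
def abelMinusIntegrand (n : ℕ) (α : ℝ) (j : ℕ) (u : ℝ → ℂ) (r ρ : ℝ) : ℂ :=
  (((ρ ^ 2 - r ^ 2) ^ (α - 1) : ℝ) : ℂ) * (u ρ / (((1 + ρ ^ 2) ^ (α + (n : ℝ) / 2) : ℝ) : ℂ)) *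
    (((r / ρ) ^ j * ρ : ℝ) : ℂ)

/-- `f^+_{j,k}(r)`, with `u = φ_{j,k}`. -/
def abelPlus (n : ℕ) (α : ℝ) (j : ℕ) (u : ℝ → ℂ) (r : ℝ) : ℂ :=
  (cAlpha n α r : ℂ) * ∫ ρ in Ioo 0 r, abelPlusIntegrand n α j u r ρ

/-- `f^-_{j,k}(r)`, with `u = φ_{j,k}`. -/
def abelMinus (n : ℕ) (α : ℝ) (j : ℕ) (u : ℝ → ℂ) (r : ℝ) : ℂ :=
  (cAlpha n α r : ℂ) * ∫ ρ in Ioi r, abelMinusIntegrand n α j u r ρ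

/-- The decomposition of `f^+ = S^α_+ φ` at the angle `θ`: the integrals `f^+_{j,k}(tan (θ/2))`
converge absolutely and are the Fourier-Laplace coefficients of `f^+(θ, ·)`. -/
def PlusExpansionAt (n : ℕ) (α : ℝ) (Y : (j : ℕ) → Fin (sphHarmDim n j) → USphere n → ℝ)
    (φ : USphere (n + 1) → ℂ) (u : (j : ℕ) → Fin (sphHarmDim n j) → ℝ → ℂ) (θ : ℝ) : Prop :=
  (∀ j k, IntegrableOn (abelPlusIntegrand n α j (u j k) (Real.tan (θ / 2)))
    (Ioo 0 (Real.tan (θ / 2)))) ∧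
  IsFourierLaplace n Y (fun ξ => SPlus n α φ (polarPt θ ξ))
    (fun j k => abelPlus n α j (u j k) (Real.tan (θ / 2)))

/-- The decomposition of `f^- = S^α_- φ` at the angle `θ`: the integrals `f^-_{j,k}(tan (θ/2))`
converge absolutely and are the Fourier-Laplace coefficients of `f^-(θ, ·)`. -/
def MinusExpansionAt (n : ℕ) (α : ℝ) (Y : (j : ℕ) → Fin (sphHarmDim n j) → USphere n → ℝ)
    (φ : USphere (n + 1) → ℂ) (u : (j : ℕ) → Fin (sphHarmDim n j) → ℝ → ℂ) (θ : ℝ) : Prop :=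
  (∀ j k, IntegrableOn (abelMinusIntegrand n α j (u j k) (Real.tan (θ / 2)))
    (Ioi (Real.tan (θ / 2)))) ∧
  IsFourierLaplace n Y (fun ξ => SMinus n α φ (polarPt θ ξ))
    (fun j k => abelMinus n α j (u j k) (Real.tan (θ / 2)))

end

/-!
Put `x = stereoPt a ξ` and `y = stereoPt b ζ`, where `a = tan (θ / 2)`. Both `x_{n+1} - y_{n+1}` and
`|x - y|²` are then explicit, and for fixed `a`, `b` the kernel `|x_{n+1} - y_{n+1}|^α / |x - y|^n`
is a constant times the Poisson kernel of the unit ball of `ℝ^n` at the point of modulus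
`s = min a b / max a b`, seen as a zonal kernel in `(ξ, ζ)`. As a function of `s`, the Poisson
integral at `s ζ` of a solid harmonic `P` of degree `j` solves a Cauchy-Euler equation, by Green's
formula on the sphere; it is regular at `0` and tends to `P ζ` as `s → 1`, hence equals `s^j P ζ`.
So the zonal operator multiplies spherical harmonics of degree `j` by a multiple of `s^j`; Fubini's
theorem then turns `S^α_±` into the Abel type integrals `f^±_{j,k}`, which gives (ii).

For (i), the case `j = 0` evaluates the mean of the kernel over a parallel: it is at most
`C(a) |x_{n+1} - y_{n+1}|^(α - 1)`. It therefore suffices that the moments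
`∫ (t - y_{n+1})^(α - 1) |φ(y)| dy` are finite for almost every height `t`. Integrating them over
`t < b` gives `α⁻¹ ∫ (b - y_{n+1})^α |φ(y)| dy`, which by `|x - y| ≤ 2` is finite at each height
`b = x_{n+1}` for which `(S^α_+ |φ|)(x)` is finite, and such heights are dense.
-/

noncomputable section

section SphereIntegrationByParts

open Metric Module InnerProductSpace
open scoped Pointwise RealInnerProductSpace Laplacian

variable {E : Type*} [NormedAddCommGroup E] [InnerProductSpace ℝ E]

theorem sum_inner_mul_apply {ι : Type*} [Fintype ι] (e : OrthonormalBasis ι ℝ E)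
    (L : E →L[ℝ] ℝ) (x : E) : ∑ i, ⟪e i, x⟫ * L (e i) = L x := by
  simpa using congrArg L (e.sum_repr' x)

theorem sum_rotation_orthonormalBasis {ι : Type*} [Fintype ι] (e : OrthonormalBasis ι ℝ E)
    (b : E) (c : ℝ) (L : E →L[ℝ] ℝ) {x : E} (hx : ‖x‖ = 1) :
    ∑ i, (⟪e i, x⟫ * (c * ⟪e i, b⟫ + ⟪e i, x⟫ * L b) -
        ⟪b, x⟫ * (c * ⟪e i, e i⟫ + ⟪e i, x⟫ * L (e i))) =
      L b - ⟪b, x⟫ * (L x + (finrank ℝ E - 1) * c) := by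
  have sum_sq : ∑ i, ⟪e i, x⟫ * ⟪e i, x⟫ = 1 := by
    simpa [real_inner_comm, hx] using e.sum_inner_mul_inner x x
  have sum_inner : ∑ i, ⟪e i, x⟫ * ⟪e i, b⟫ = ⟪b, x⟫ := by
    simpa [real_inner_comm, mul_comm] using e.sum_inner_mul_inner b x
  have sum_one : ∑ i, ⟪e i, e i⟫ = (finrank ℝ E : ℝ) := by
    simp [finrank_eq_card_basis e.toBasis]
  calc _ = c * ∑ i, ⟪e i, x⟫ * ⟪e i, b⟫ + L b * ∑ i, ⟪e i, x⟫ * ⟪e i, x⟫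
        - ⟪b, x⟫ * (c * ∑ i, ⟪e i, e i⟫ + ∑ i, ⟪e i, x⟫ * L (e i)) := by
        simp only [Finset.mul_sum, ← Finset.sum_add_distrib, ← Finset.sum_sub_distrib]
        exact Finset.sum_congr rfl fun i _ => by ring
    _ = _ := by rw [sum_sq, sum_inner, sum_inner_mul_apply, sum_one]; ring

theorem real_inner_mem_Icc_of_mem_sphere (ζ : sphere (0 : E) 1) {x : E}
    (hx : x ∈ sphere (0 : E) 1) : ⟪(ζ : E), x⟫ ∈ Icc (-1 : ℝ) 1 := by
  have := abs_real_inner_le_norm (ζ : E) x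
  rwa [norm_eq_of_mem_sphere, mem_sphere_zero_iff_norm.1 hx, mul_one, abs_le] at this

theorem continuousOn_zonal (ζ : sphere (0 : E) 1) {h : ℝ → ℝ} (hh : ContinuousOn h (Icc (-1) 1)) :
    ContinuousOn (fun x => h ⟪(ζ : E), x⟫) (sphere (0 : E) 1) :=
  hh.comp (innerSL ℝ (ζ : E)).continuous.continuousOn fun _ => real_inner_mem_Icc_of_mem_sphere ζ

theorem hasFDerivAt_zonal (ζ : sphere (0 : E) 1) {h h' : ℝ → ℝ}
    (hh : ∀ t ∈ Icc (-1 : ℝ) 1, HasDerivAt h (h' t) t) {x : E} (hx : x ∈ sphere (0 : E) 1) :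
    HasFDerivAt (fun x => h ⟪(ζ : E), x⟫) (h' ⟪(ζ : E), x⟫ • innerSL ℝ (ζ : E)) x :=
  (hh _ (real_inner_mem_Icc_of_mem_sphere ζ hx)).comp_hasFDerivAt x (innerSL ℝ (ζ : E)).hasFDerivAt

variable [FiniteDimensional ℝ E]

theorem laplacian_eq_sum_fderiv_fderiv {ι : Type*} [Fintype ι] (e : OrthonormalBasis ι ℝ E)
    (p : E → ℝ) (x : E) : Δ p x = ∑ i, fderiv ℝ (fderiv ℝ p) x (e i) (e i) := by
  simp [laplacian_eq_iteratedFDeriv_orthonormalBasis p e, iteratedFDeriv_two_apply]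

/-- The solid harmonics of degree `j`: the harmonic functions on `E` that are homogeneous of degree
`j`. Their restrictions to the unit sphere are the spherical harmonics of degree `j`. -/
structure IsSolidHarmonic (j : ℕ) (p : E → ℝ) : Prop where
  harmonicOnNhd : HarmonicOnNhd p univ
  apply_smul : ∀ (r : ℝ) (x : E), p (r • x) = r ^ j * p x

theorem isSolidHarmonic_one : IsSolidHarmonic 0 (fun _ : E => (1 : ℝ)) :=
  ⟨fun _ _ => harmonicAt_const 1, by simp⟩

namespace IsSolidHarmonic

variable {j : ℕ} {p : E → ℝ}

theorem contDiff (hp : IsSolidHarmonic j p) : ContDiff ℝ 2 p :=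
  contDiff_iff_contDiffAt.2 fun x => (hp.harmonicOnNhd x (mem_univ x)).1

theorem laplacian_eq_zero (hp : IsSolidHarmonic j p) (x : E) : Δ p x = 0 :=
  (hp.harmonicOnNhd x (mem_univ x)).2.self_of_nhds

theorem fderiv_apply_self (hp : IsSolidHarmonic j p) (x : E) : fderiv ℝ p x x = j * p x := by
  have along_ray : HasDerivAt (fun r : ℝ => p (r • x)) (fderiv ℝ p x x) 1 := by
    have := ((hp.contDiff.differentiable two_ne_zero) ((1 : ℝ) • x)).hasFDerivAt.comp_hasDerivAt
      (1 : ℝ) ((hasDerivAt_id (1 : ℝ)).smul_const x)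
    simpa [Function.comp_def] using this
  simp only [hp.apply_smul] at along_ray
  exact along_ray.unique (by simpa using (hasDerivAt_pow j (1 : ℝ)).mul_const (p x))

theorem fderiv_fderiv_apply_self (hp : IsSolidHarmonic j p) (x : E) :
    fderiv ℝ (fderiv ℝ p) x x x = j * (j - 1) * p x := by
  have differentiable_fderiv : Differentiable ℝ (fderiv ℝ p) :=
    (hp.contDiff.fderiv_right (m := 1) (by norm_num)).differentiable one_ne_zero
  have euler : (fun y => fderiv ℝ p y y) = fun y => j * p y := funext hp.fderiv_apply_self
  have fderiv_euler := congrArg (fun f => fderiv ℝ f x x) euler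
  simp only [fderiv_clm_apply (differentiable_fderiv x) differentiableAt_fun_id,
    fderiv_const_mul (hp.contDiff.differentiable two_ne_zero x), fderiv_fun_id,
    ContinuousLinearMap.comp_id, add_apply, ContinuousLinearMap.flip_apply, smul_apply,
    smul_eq_mul] at fderiv_euler
  linear_combination fderiv_euler + (j - 1) * hp.fderiv_apply_self x

end IsSolidHarmonic

variable [MeasurableSpace E] [BorelSpace E]

theorem integrable_toSphere_of_continuousOn {f : E → ℝ} (hf : ContinuousOn f (sphere 0 1)) :
    Integrable (fun ξ : sphere (0 : E) 1 => f ξ) volume.toSphere :=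
  (continuousOn_iff_continuous_domRestrict.1 hf).integrable_of_hasCompactSupport
    (HasCompactSupport.of_compactSpace _)

theorem integral_toSphere_comp_linearIsometryEquiv (e : E ≃ₗᵢ[ℝ] E) {f : E → ℝ}
    (hf : ContinuousOn f (sphere 0 1)) :
    ∫ ξ : sphere (0 : E) 1, f (e ξ) ∂volume.toSphere =
      ∫ ξ : sphere (0 : E) 1, f ξ ∂volume.toSphere := by
  have mapsTo : ∀ ξ : sphere (0 : E) 1, e ξ ∈ sphere (0 : E) 1 := fun ξ => by simp
  set g : sphere (0 : E) 1 → sphere (0 : E) 1 := fun ξ => ⟨e ξ, mapsTo ξ⟩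
  have hg : Continuous g := (e.continuous.comp continuous_subtype_val).subtype_mk mapsTo
  have image_preimage (s : Set (sphere (0 : E) 1)) :
      Ioo (0 : ℝ) 1 • (Subtype.val '' (g ⁻¹' s)) = e ⁻¹' (Ioo (0 : ℝ) 1 • (Subtype.val '' s)) := by
    ext x
    simp only [Set.mem_smul, Set.mem_image, mem_preimage]
    constructor
    · rintro ⟨r, hr, _, ⟨ξ, hξ, rfl⟩, rfl⟩
      exact ⟨r, hr, e ξ, ⟨g ξ, hξ, rfl⟩, (e.map_smul r ξ).symm⟩
    · rintro ⟨r, hr, _, ⟨ξ, hξ, rfl⟩, hx⟩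
      refine ⟨r, hr, e.symm ξ, ⟨⟨e.symm ξ, by simp⟩, by simpa [g] using hξ, rfl⟩, e.injective ?_⟩
      simpa using hx
  have map_eq : (volume : Measure E).toSphere.map g = volume.toSphere := by
    ext s hs
    rw [Measure.map_apply hg.measurable hs, Measure.toSphere_apply' _ (hg.measurable hs),
      Measure.toSphere_apply' _ hs, image_preimage,
      e.measurePreserving.measure_preimage_emb e.toHomeomorph.measurableEmbedding]
  conv_rhs => rw [← map_eq]
  exact (integral_map hg.aemeasurable
    (continuousOn_iff_continuous_domRestrict.1 hf).aestronglyMeasurable).symm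

theorem integral_toSphere_skewAdjoint_eq_zero {A : E →L[ℝ] E} (hA : A ∈ skewAdjoint (E →L[ℝ] E))
    {f : E → ℝ} {f' : E → E →L[ℝ] ℝ} (hf : ∀ x ∈ sphere (0 : E) 1, HasFDerivAt f (f' x) x)
    (hf' : ContinuousOn f' (sphere 0 1)) :
    ∫ ξ : sphere (0 : E) 1, f' ξ (A ξ) ∂volume.toSphere = 0 := by
  let _ : NormedAlgebra ℚ (E →L[ℝ] E) := .restrictScalars ℚ ℝ _
  let U (t : ℝ) : E ≃ₗᵢ[ℝ] E := Unitary.linearIsometryEquiv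
    ⟨NormedSpace.exp (t • A), NormedSpace.exp_mem_unitary_of_mem_skewAdjoint
      (skewAdjoint.smul_mem t hA)⟩
  have U_mem (t : ℝ) (ξ : sphere (0 : E) 1) : U t ξ ∈ sphere (0 : E) 1 := by simp
  have hf_cont : ContinuousOn f (sphere 0 1) := fun x hx =>
    (hf x hx).continuousAt.continuousWithinAt
  have hasDerivAt_U (t : ℝ) (x : E) : HasDerivAt (fun t => U t x) (A (U t x)) t :=
    (hasDerivAt_exp_smul_const' A t).clm_apply (hasDerivAt_const t x) |>.congr_deriv (by
      simp [U]; rfl)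
  have U_zero (x : E) : U 0 x = x := by
    change NormedSpace.exp ((0 : ℝ) • A) x = x
    simp
  obtain ⟨C, hC⟩ := (isCompact_sphere (0 : E) 1).exists_bound_of_continuousOn hf'
  have hasDerivAt_integral := (hasDerivAt_integral_of_dominated_loc_of_deriv_le
    (μ := (volume : Measure E).toSphere) (F := fun t ξ => f (U t ξ))
    (F' := fun t ξ => f' (U t ξ) (A (U t ξ))) (bound := fun _ => C * ‖A‖) (x₀ := 0)
    (Metric.ball_mem_nhds 0 one_pos) ?_ ?_ ?_ ?_ (integrable_const _) ?_).2
  · have integral_const : (fun t => ∫ ξ : sphere (0 : E) 1, f (U t ξ) ∂volume.toSphere) =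
        fun _ => ∫ ξ : sphere (0 : E) 1, f ξ ∂volume.toSphere :=
      funext fun t => integral_toSphere_comp_linearIsometryEquiv (U t) hf_cont
    rw [integral_const] at hasDerivAt_integral
    simpa only [U_zero] using hasDerivAt_integral.unique (hasDerivAt_const _ _)
  · refine .of_forall fun t => Continuous.aestronglyMeasurable ?_
    exact hf_cont.comp_continuous ((U t).continuous.comp continuous_subtype_val) (U_mem t)
  · exact integrable_toSphere_of_continuousOn
      (hf_cont.comp (U 0).continuous.continuousOn fun x hx => U_mem 0 ⟨x, hx⟩)
  · refine Continuous.aestronglyMeasurable (Continuous.clm_apply ?_ (by fun_prop))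
    exact hf'.comp_continuous ((U 0).continuous.comp continuous_subtype_val) (U_mem 0)
  · refine .of_forall fun ξ t _ => ?_
    calc ‖f' (U t ξ) (A (U t ξ))‖ ≤ ‖f' (U t ξ)‖ * (‖A‖ * ‖U t ξ‖) :=
          (ContinuousLinearMap.le_opNorm _ _).trans (by gcongr; exact A.le_opNorm _)
      _ ≤ C * ‖A‖ := by
          rw [mem_sphere_zero_iff_norm.1 (U_mem t ξ), mul_one]
          exact mul_le_mul_of_nonneg_right (hC _ (U_mem t ξ)) (norm_nonneg A)
  · exact .of_forall fun ξ t _ =>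
      (hf _ (U_mem t ξ)).comp_hasDerivAt t (hasDerivAt_U t ξ)

theorem integral_toSphere_rotation_eq_zero (a b : E) {f : E → ℝ} {f' : E → E →L[ℝ] ℝ}
    (hf : ∀ x ∈ sphere (0 : E) 1, HasFDerivAt f (f' x) x) (hf' : ContinuousOn f' (sphere 0 1)) :
    ∫ ξ : sphere (0 : E) 1, (⟪a, (ξ : E)⟫ * f' ξ b - ⟪b, (ξ : E)⟫ * f' ξ a)
      ∂volume.toSphere = 0 := by
  let A : E →L[ℝ] E := InnerProductSpace.rankOne ℝ b a - InnerProductSpace.rankOne ℝ a b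
  have hA : A ∈ skewAdjoint (E →L[ℝ] E) := by
    rw [skewAdjoint.mem_iff, ContinuousLinearMap.star_eq_adjoint]
    simp [A]
  simpa [A] using integral_toSphere_skewAdjoint_eq_zero hA hf hf'

theorem integral_toSphere_fderiv_apply (b : E) {f : E → ℝ} {f' : E → E →L[ℝ] ℝ}
    (hf : ∀ x ∈ sphere (0 : E) 1, HasFDerivAt f (f' x) x) (hf' : ContinuousOn f' (sphere 0 1)) :
    ∫ ξ : sphere (0 : E) 1, f' ξ b ∂volume.toSphere =
      ∫ ξ : sphere (0 : E) 1, ⟪b, (ξ : E)⟫ * (f' ξ ξ + (finrank ℝ E - 1) * f ξ)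
        ∂volume.toSphere := by
  let e := stdOrthonormalBasis ℝ E
  have hf_cont : ContinuousOn f (sphere 0 1) := fun x hx =>
    (hf x hx).continuousAt.continuousWithinAt
  let g' (i) (x : E) : E →L[ℝ] ℝ := f x • innerSL ℝ (e i) + ⟪e i, x⟫ • f' x
  have hg' (i) : ContinuousOn (g' i) (sphere 0 1) := by fun_prop
  have rotation (i) := integral_toSphere_rotation_eq_zero (e i) b (f' := g' i)
    (fun x hx => (hf x hx).mul (innerSL ℝ (e i)).hasFDerivAt) (hg' i)
  have integrable_rotation (i) : Integrable (fun ξ : sphere (0 : E) 1 =>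
      ⟪e i, (ξ : E)⟫ * g' i ξ b - ⟪b, (ξ : E)⟫ * g' i ξ (e i)) volume.toSphere :=
    integrable_toSphere_of_continuousOn
      (f := fun x => ⟪e i, x⟫ * g' i x b - ⟪b, x⟫ * g' i x (e i)) (by fun_prop)
  rw [← sub_eq_zero, ← integral_sub]
  · calc _ = ∫ ξ : sphere (0 : E) 1, ∑ i,
          (⟪e i, (ξ : E)⟫ * g' i ξ b - ⟪b, (ξ : E)⟫ * g' i ξ (e i)) ∂volume.toSphere :=
          integral_congr_ae <| .of_forall fun ξ =>
            (sum_rotation_orthonormalBasis e b (f ξ) (f' ξ) (norm_eq_of_mem_sphere ξ)).symm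
      _ = 0 := by
          rw [integral_finsetSum _ fun i _ => integrable_rotation i]
          exact Finset.sum_eq_zero fun i _ => rotation i
  · exact integrable_toSphere_of_continuousOn (f := fun x => f' x b) (by fun_prop)
  · exact integrable_toSphere_of_continuousOn
      (f := fun x => ⟪b, x⟫ * (f' x x + (finrank ℝ E - 1) * f x)) <|
        (innerSL ℝ b).continuous.continuousOn.mul
          ((hf'.clm_apply continuousOn_id).add (continuousOn_const.mul hf_cont))

theorem integral_toSphere_divergence {ι : Type*} [Fintype ι] (e : OrthonormalBasis ι ℝ E)
    {f : ι → E → ℝ} {f' : ι → E → E →L[ℝ] ℝ}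
    (hf : ∀ i, ∀ x ∈ sphere (0 : E) 1, HasFDerivAt (f i) (f' i x) x)
    (hf' : ∀ i, ContinuousOn (f' i) (sphere 0 1)) :
    ∫ ξ : sphere (0 : E) 1, ∑ i, f' i ξ (e i) ∂volume.toSphere =
      ∫ ξ : sphere (0 : E) 1, ∑ i, ⟪e i, (ξ : E)⟫ * (f' i ξ ξ + (finrank ℝ E - 1) * f i ξ)
        ∂volume.toSphere := by
  have continuousOn_radial (i) :=
    ((hf' i).clm_apply continuousOn_id).add <|
      continuousOn_const (c := (finrank ℝ E - 1 : ℝ)) |>.mul fun x hx =>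
         (hf i x hx).continuousAt.continuousWithinAt
  rw [integral_finsetSum, integral_finsetSum]
  · exact Finset.sum_congr rfl fun i _ => integral_toSphere_fderiv_apply (e i) (hf i) (hf' i)
  · exact fun i _ => integrable_toSphere_of_continuousOn
      ((innerSL ℝ (e i)).continuous.continuousOn.mul (continuousOn_radial i))
  · exact fun i _ => integrable_toSphere_of_continuousOn
      (f := fun x => f' i x (e i)) ((hf' i).clm_apply continuousOn_const)

theorem integral_toSphere_green {w p : E → ℝ} {w' : E → E}
    (hw : ∀ x ∈ sphere (0 : E) 1, HasGradientAt w (w' x) x) (hw' : ContinuousOn w' (sphere 0 1))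
    (hp : ContDiff ℝ 2 p) :
    ∫ ξ : sphere (0 : E) 1, (w ξ * Δ p ξ + fderiv ℝ p ξ (w' ξ)) ∂volume.toSphere =
      ∫ ξ : sphere (0 : E) 1, (⟪w' ξ, (ξ : E)⟫ * fderiv ℝ p ξ ξ +
        w ξ * (fderiv ℝ (fderiv ℝ p) ξ ξ ξ + (finrank ℝ E - 1) * fderiv ℝ p ξ ξ))
        ∂volume.toSphere := by
  let e := stdOrthonormalBasis ℝ E
  have hw_cont : ContinuousOn w (sphere 0 1) := fun x hx =>
    (hw x hx).hasFDerivAt.continuousAt.continuousWithinAt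
  have contDiff_fderiv : ContDiff ℝ 1 (fderiv ℝ p) := hp.fderiv_right (by norm_num)
  let q (i) (x : E) : ℝ := fderiv ℝ p x (e i)
  have contDiff_q (i) : ContDiff ℝ 1 (q i) := contDiff_fderiv.clm_apply contDiff_const
  have fderiv_q (i) (x v : E) : fderiv ℝ (q i) x v = fderiv ℝ (fderiv ℝ p) x v (e i) := by
    simp [q, fderiv_clm_apply (contDiff_fderiv.differentiable one_ne_zero x)]
  have divergence := integral_toSphere_divergence e
    (f := fun i x => w x * q i x)
    (f' := fun i x => w x • fderiv ℝ (q i) x + q i x • innerSL ℝ (w' x))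
    (fun i x hx => (hw x hx).hasFDerivAt.mul
      ((contDiff_q i).differentiable one_ne_zero x).hasFDerivAt)
    (fun i => (hw_cont.smul ((contDiff_q i).continuous_fderiv one_ne_zero).continuousOn).add
      ((contDiff_q i).continuous.continuousOn.smul ((innerSL ℝ).continuous.comp_continuousOn hw')))
  convert! divergence using 3 with ξ ξ
  · simp only [add_apply, smul_apply, smul_eq_mul,
      fderiv_q, innerSL_apply_apply, Finset.sum_add_distrib, ← Finset.mul_sum,
      laplacian_eq_sum_fderiv_fderiv e, ← sum_inner_mul_apply e (fderiv ℝ p ξ) (w' ξ), q,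
      real_inner_comm, mul_comm]
  · have radial := sum_inner_mul_apply e (fderiv ℝ p ξ) ξ
    have radial_radial := sum_inner_mul_apply e (fderiv ℝ (fderiv ℝ p) ξ ξ) ξ
    simp only [add_apply, smul_apply, smul_eq_mul,
      fderiv_q, innerSL_apply_apply, q, ← radial, ← radial_radial, Finset.mul_sum,
      ← Finset.sum_add_distrib]
    exact Finset.sum_congr rfl fun i _ => by ring

theorem integrable_zonal_mul (ζ : sphere (0 : E) 1) {h : ℝ → ℝ} {p : E → ℝ}
    (hh : ContinuousOn h (Icc (-1) 1)) (hp : ContinuousOn p (sphere 0 1)) :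
    Integrable (fun ξ : sphere (0 : E) 1 => h ⟪(ζ : E), ξ⟫ * p ξ) volume.toSphere :=
  integrable_toSphere_of_continuousOn (f := fun x => h ⟪(ζ : E), x⟫ * p x)
    ((continuousOn_zonal ζ hh).mul hp)

namespace IsSolidHarmonic

variable {j : ℕ} {p : E → ℝ}

theorem integral_toSphere_green_zonal (hp : IsSolidHarmonic j p) (ζ : sphere (0 : E) 1)
    {g g' : ℝ → ℝ} (hg : ∀ t ∈ Icc (-1 : ℝ) 1, HasDerivAt g (g' t) t)
    (hg' : ContinuousOn g' (Icc (-1) 1)) :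
    ∫ ξ : sphere (0 : E) 1, g' ⟪(ζ : E), ξ⟫ * fderiv ℝ p ξ ζ ∂volume.toSphere =
      ∫ ξ : sphere (0 : E) 1, (j * ⟪(ζ : E), ξ⟫ * g' ⟪(ζ : E), ξ⟫ +
        j * (j + finrank ℝ E - 2) * g ⟪(ζ : E), ξ⟫) * p ξ ∂volume.toSphere := by
  have green := integral_toSphere_green (w := fun x => g ⟪(ζ : E), x⟫)
    (w' := fun x => g' ⟪(ζ : E), x⟫ • (ζ : E))
    (fun x hx => (hasFDerivAt_zonal ζ hg hx).congr_fderiv (by ext; simp))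
    ((continuousOn_zonal ζ hg').smul continuousOn_const) hp.contDiff
  simp only [hp.laplacian_eq_zero, hp.fderiv_apply_self, hp.fderiv_fderiv_apply_self, mul_zero,
    zero_add, map_smul, smul_eq_mul, real_inner_smul_left] at green
  rw [green]
  exact integral_congr_ae (.of_forall fun ξ => by ring)

theorem integral_toSphere_fderiv_zonal_mul (hp : IsSolidHarmonic j p) (ζ : sphere (0 : E) 1)
    {g g' : ℝ → ℝ} (hg : ∀ t ∈ Icc (-1 : ℝ) 1, HasDerivAt g (g' t) t)
    (hg' : ContinuousOn g' (Icc (-1) 1)) :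
    ∫ ξ : sphere (0 : E) 1, (g' ⟪(ζ : E), ξ⟫ * p ξ + g ⟪(ζ : E), ξ⟫ * fderiv ℝ p ξ ζ)
        ∂volume.toSphere =
      ∫ ξ : sphere (0 : E) 1, ⟪(ζ : E), ξ⟫ * (⟪(ζ : E), ξ⟫ * g' ⟪(ζ : E), ξ⟫ +
        (j + finrank ℝ E - 1) * g ⟪(ζ : E), ξ⟫) * p ξ ∂volume.toSphere := by
  have hg_cont : ContinuousOn g (Icc (-1) 1) :=
    fun t ht => (hg t ht).continuousAt.continuousWithinAt
  have byParts := integral_toSphere_fderiv_apply (ζ : E) (f := fun x => g ⟪(ζ : E), x⟫ * p x)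
    (fun x hx => (hasFDerivAt_zonal ζ hg hx).mul
      (hp.contDiff.differentiable two_ne_zero x).hasFDerivAt)
    (((continuousOn_zonal ζ hg_cont).smul
      (hp.contDiff.continuous_fderiv two_ne_zero).continuousOn).add
      (hp.contDiff.continuous.continuousOn.smul
        ((continuousOn_zonal ζ hg').smul continuousOn_const)))
  simp only [add_apply, smul_apply, innerSL_apply_apply, smul_eq_mul, hp.fderiv_apply_self,
    real_inner_self_eq_norm_sq, norm_eq_of_mem_sphere, one_pow, mul_one] at byParts
  convert! byParts using 1 <;> exact integral_congr_ae (.of_forall fun ξ => by ring)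

theorem integral_toSphere_gegenbauer (hp : IsSolidHarmonic j p) (ζ : sphere (0 : E) 1)
    {g g' g'' : ℝ → ℝ} (hg : ∀ t ∈ Icc (-1 : ℝ) 1, HasDerivAt g (g' t) t)
    (hg' : ∀ t ∈ Icc (-1 : ℝ) 1, HasDerivAt g' (g'' t) t) (hg'' : ContinuousOn g'' (Icc (-1) 1)) :
    ∫ ξ : sphere (0 : E) 1, ((1 - ⟪(ζ : E), ξ⟫ ^ 2) * g'' ⟪(ζ : E), ξ⟫ -
        (finrank ℝ E - 1) * ⟪(ζ : E), ξ⟫ * g' ⟪(ζ : E), ξ⟫) * p ξ ∂volume.toSphere =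
      -(j * (j + finrank ℝ E - 2)) *
        ∫ ξ : sphere (0 : E) 1, g ⟪(ζ : E), ξ⟫ * p ξ ∂volume.toSphere := by
  have hg_cont : ContinuousOn g (Icc (-1) 1) :=
    fun t ht => (hg t ht).continuousAt.continuousWithinAt
  have hg'_cont : ContinuousOn g' (Icc (-1) 1) :=
    fun t ht => (hg' t ht).continuousAt.continuousWithinAt
  have hp_cont : ContinuousOn p (sphere 0 1) := hp.contDiff.continuous.continuousOn
  have hDp_cont : ContinuousOn (fun x => fderiv ℝ p x ζ) (sphere 0 1) := by
    have := hp.contDiff.continuous_fderiv two_ne_zero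
    fun_prop
  have green := hp.integral_toSphere_green_zonal ζ hg hg'_cont
  have byParts := hp.integral_toSphere_fderiv_zonal_mul ζ hg' hg''
  have integrable_g := integrable_zonal_mul ζ hg_cont hp_cont
  have integrable_g'' := integrable_zonal_mul ζ hg'' hp_cont
  have integrable_green := integrable_zonal_mul ζ (p := p)
    (h := fun t => j * t * g' t + j * (j + finrank ℝ E - 2) * g t) (by fun_prop) hp_cont
  have integrable_byParts := integrable_zonal_mul ζ (p := p)
    (h := fun t => t * (t * g'' t + (j + finrank ℝ E - 1) * g' t)) (by fun_prop) hp_cont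
  rw [integral_add integrable_g'' (integrable_zonal_mul ζ hg'_cont hDp_cont), green] at byParts
  calc _ = ∫ ξ : sphere (0 : E) 1, (g'' ⟪(ζ : E), ξ⟫ * p ξ + (j * ⟪(ζ : E), ξ⟫ * g' ⟪(ζ : E), ξ⟫ +
          j * (j + finrank ℝ E - 2) * g ⟪(ζ : E), ξ⟫) * p ξ - ⟪(ζ : E), ξ⟫ * (⟪(ζ : E), ξ⟫ *
          g'' ⟪(ζ : E), ξ⟫ + (j + finrank ℝ E - 1) * g' ⟪(ζ : E), ξ⟫) * p ξ -
          j * (j + finrank ℝ E - 2) * (g ⟪(ζ : E), ξ⟫ * p ξ)) ∂volume.toSphere :=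
        integral_congr_ae (.of_forall fun ξ => by ring)
    _ = _ := by
        rw [integral_sub ((integrable_g''.fun_add integrable_green).sub' integrable_byParts)
            (integrable_g.const_mul _), integral_sub (integrable_g''.fun_add integrable_green)
            integrable_byParts, integral_add integrable_g'' integrable_green, byParts,
            sub_self, zero_sub, integral_const_mul, neg_mul]

end IsSolidHarmonic

theorem hasDerivAt_integral_zonal_mul (ζ : sphere (0 : E) 1) {p : E → ℝ}
    (hp : ContinuousOn p (sphere 0 1)) {h h' : ℝ → ℝ → ℝ}
    (hh : ∀ s ∈ Ioo (-1 : ℝ) 1, ∀ t ∈ Icc (-1 : ℝ) 1, HasDerivAt (h · t) (h' s t) s)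
    (hcont : ∀ s ∈ Ioo (-1 : ℝ) 1, ContinuousOn (h s) (Icc (-1) 1))
    (hcont' : ContinuousOn (fun x : ℝ × ℝ => h' x.1 x.2) (Ioo (-1) 1 ×ˢ Icc (-1) 1))
    {s : ℝ} (hs : s ∈ Ioo (-1 : ℝ) 1) :
    HasDerivAt (fun s => ∫ ξ : sphere (0 : E) 1, h s ⟪(ζ : E), ξ⟫ * p ξ ∂volume.toSphere)
      (∫ ξ : sphere (0 : E) 1, h' s ⟪(ζ : E), ξ⟫ * p ξ ∂volume.toSphere) s := by
  obtain ⟨a, ha, has⟩ := exists_between hs.1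
  obtain ⟨b, hsb, hb⟩ := exists_between hs.2
  obtain ⟨C, hC⟩ := (isCompact_Icc.prod isCompact_Icc).exists_bound_of_continuousOn
    (hcont'.mono (prod_mono_left fun x (hx : x ∈ Icc a b) =>
      ⟨ha.trans_le hx.1, hx.2.trans_lt hb⟩))
  have integrable_mul {s : ℝ} (hs : s ∈ Ioo (-1 : ℝ) 1) := integrable_zonal_mul ζ (hcont s hs) hp
  have integrable_mul' : Integrable _ _ := integrable_zonal_mul ζ (h := h' s)
    (hcont'.comp (f := fun t => (s, t)) (by fun_prop) fun t ht => ⟨hs, ht⟩) hp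
  refine (hasDerivAt_integral_of_dominated_loc_of_deriv_le (s := Ioo a b)
    (F := fun s (ξ : sphere (0 : E) 1) => h s ⟪(ζ : E), ξ⟫ * p ξ)
    (F' := fun s ξ => h' s ⟪(ζ : E), ξ⟫ * p ξ)
    (bound := fun ξ : sphere (0 : E) 1 => C * |p ξ|) (Ioo_mem_nhds has hsb) ?_ (integrable_mul hs)
    integrable_mul'.aestronglyMeasurable (.of_forall fun ξ x hx => ?_)
    ((integrable_toSphere_of_continuousOn hp.abs).const_mul C) (.of_forall fun ξ x hx => ?_)).2
  · filter_upwards [Ioo_mem_nhds hs.1 hs.2] with x hx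
    exact (integrable_mul hx).aestronglyMeasurable
  · rw [norm_mul, Real.norm_eq_abs (p ξ)]
    exact mul_le_mul_of_nonneg_right (hC (x, _) ⟨Ioo_subset_Icc_self hx,
      real_inner_mem_Icc_of_mem_sphere ζ ξ.2⟩) (abs_nonneg _)
  · exact (hh x ⟨ha.trans hx.1, hx.2.trans hb⟩ _
      (real_inner_mem_Icc_of_mem_sphere ζ ξ.2)).mul_const _

end SphereIntegrationByParts

section PoissonKernel

/-- The squared distance `1 + s² - 2 s t` between `s ζ` and `ξ`, for unit vectors `ζ`, `ξ` with
inner product `t`. -/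
def chordSq (s t : ℝ) : ℝ := 1 + s ^ 2 - 2 * s * t

theorem chordSq_pos {s t : ℝ} (hs : s ∈ Ioo (-1 : ℝ) 1) (ht : t ∈ Icc (-1 : ℝ) 1) :
    0 < chordSq s t := by
  unfold chordSq
  rcases le_total 0 s with h | h
  · nlinarith [mul_nonneg h (sub_nonneg.2 ht.2), pow_pos (sub_pos.2 hs.2) 2]
  · nlinarith [mul_nonneg (neg_nonneg.2 h) (sub_nonneg.2 ht.1), pow_pos (sub_pos.2 hs.1) 2]

theorem hasDerivAt_chordSq_rpow_left {l s t : ℝ} (h : 0 < chordSq s t) :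
    HasDerivAt (fun s => chordSq s t ^ l) (2 * l * (s - t) * chordSq s t ^ (l - 1)) s := by
  have hasDerivAt_chordSq : HasDerivAt (chordSq · t) (2 * s - 2 * t) s := by
    simpa using! (((hasDerivAt_id' s).pow 2).const_add 1).sub
      (((hasDerivAt_id' s).const_mul 2).mul_const t)
  exact (hasDerivAt_chordSq.rpow_const (p := l) (.inl h.ne')).congr_deriv (by ring)

theorem hasDerivAt_chordSq_rpow_right {l s t : ℝ} (h : 0 < chordSq s t) :
    HasDerivAt (fun t => chordSq s t ^ l) (-2 * l * s * chordSq s t ^ (l - 1)) t := by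
  have hasDerivAt_chordSq : HasDerivAt (chordSq s ·) (-(2 * s)) t := by
    simpa using! ((hasDerivAt_id' t).const_mul (2 * s)).const_sub (1 + s ^ 2)
  exact (hasDerivAt_chordSq.rpow_const (p := l) (.inl h.ne')).congr_deriv (by ring)

theorem continuousOn_chordSq_rpow (l : ℝ) :
    ContinuousOn (fun x : ℝ × ℝ => chordSq x.1 x.2 ^ l) (Ioo (-1) 1 ×ˢ Icc (-1) 1) :=
  ContinuousOn.rpow_const (by unfold chordSq; fun_prop)
    fun _ hx => .inl (chordSq_pos hx.1 hx.2).ne'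

theorem continuousOn_chordSq_rpow_right (l : ℝ) {s : ℝ} (hs : s ∈ Ioo (-1 : ℝ) 1) :
    ContinuousOn (fun t => chordSq s t ^ l) (Icc (-1) 1) :=
  (continuousOn_chordSq_rpow l).comp (f := fun t => (s, t)) (by fun_prop) fun _ ht => ⟨hs, ht⟩

/-- The Poisson kernel `(1 - s²) / |s ζ - ξ|^{2l}` of the unit ball of `ℝ^n` (where `l = n / 2`),
without the factor that normalizes its integral, in terms of the radius `s` and `t = ⟨ζ, ξ⟩`. -/
def zonalPoissonKernel (l s t : ℝ) : ℝ := (1 - s ^ 2) * chordSq s t ^ (-l)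

/-- The derivative of `zonalPoissonKernel` in the radius. -/
def zonalPoissonKernelDeriv (l s t : ℝ) : ℝ :=
  -2 * s * chordSq s t ^ (-l) - 2 * l * (1 - s ^ 2) * (s - t) * chordSq s t ^ (-l - 1)

/-- The second derivative of `zonalPoissonKernel` in the radius. -/
def zonalPoissonKernelDeriv₂ (l s t : ℝ) : ℝ :=
  -2 * chordSq s t ^ (-l) + (8 * l * s * (s - t) - 2 * l * (1 - s ^ 2)) * chordSq s t ^ (-l - 1)
    + 4 * l * (l + 1) * (1 - s ^ 2) * (s - t) ^ 2 * chordSq s t ^ (-l - 2)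

theorem zonalPoissonKernel_nonneg (l : ℝ) {s t : ℝ} (hs : s ∈ Ioo (-1 : ℝ) 1)
    (ht : t ∈ Icc (-1 : ℝ) 1) : 0 ≤ zonalPoissonKernel l s t :=
  mul_nonneg (by nlinarith [hs.1, hs.2]) (Real.rpow_nonneg (chordSq_pos hs ht).le _)

theorem hasDerivAt_zonalPoissonKernel {l s t : ℝ} (h : 0 < chordSq s t) :
    HasDerivAt (zonalPoissonKernel l · t) (zonalPoissonKernelDeriv l s t) s := by
  have hasDerivAt_one_sub_sq : HasDerivAt (fun s : ℝ => 1 - s ^ 2) (-2 * s) s := by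
    simpa using ((hasDerivAt_id' s).pow 2).const_sub 1
  exact (hasDerivAt_one_sub_sq.mul (hasDerivAt_chordSq_rpow_left (l := -l) h)).congr_deriv
    (by unfold zonalPoissonKernelDeriv; ring)

theorem hasDerivAt_zonalPoissonKernelDeriv {l s t : ℝ} (h : 0 < chordSq s t) :
    HasDerivAt (zonalPoissonKernelDeriv l · t) (zonalPoissonKernelDeriv₂ l s t) s := by
  have hasDerivAt_one_sub_sq : HasDerivAt (fun s : ℝ => 2 * l * (1 - s ^ 2))
      (2 * l * (-2 * s)) s := by
    simpa using (((hasDerivAt_id' s).pow 2).const_sub 1).const_mul (2 * l)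
  refine ((((hasDerivAt_id' s).const_mul (-2)).mul
    (hasDerivAt_chordSq_rpow_left (l := -l) h)).sub
    ((hasDerivAt_one_sub_sq.mul ((hasDerivAt_id' s).sub_const t)).mul
      (hasDerivAt_chordSq_rpow_left (l := -l - 1) h))).congr_deriv ?_
  rw [zonalPoissonKernelDeriv₂, show -l - 1 - 1 = -l - 2 by ring]
  simp only [Pi.mul_apply]
  ring

theorem continuousOn_zonalPoissonKernel (l : ℝ) {s : ℝ} (hs : s ∈ Ioo (-1 : ℝ) 1) :
    ContinuousOn (zonalPoissonKernel l s) (Icc (-1) 1) :=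
  continuousOn_const.mul (continuousOn_chordSq_rpow_right (-l) hs)

theorem continuousOn_zonalPoissonKernelDeriv (l : ℝ) :
    ContinuousOn (fun x : ℝ × ℝ => zonalPoissonKernelDeriv l x.1 x.2)
      (Ioo (-1) 1 ×ˢ Icc (-1) 1) := by
  have := continuousOn_chordSq_rpow (-l)
  have := continuousOn_chordSq_rpow (-l - 1)
  unfold zonalPoissonKernelDeriv
  fun_prop

theorem continuousOn_zonalPoissonKernelDeriv₂ (l : ℝ) :
    ContinuousOn (fun x : ℝ × ℝ => zonalPoissonKernelDeriv₂ l x.1 x.2)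
      (Ioo (-1) 1 ×ˢ Icc (-1) 1) := by
  have := continuousOn_chordSq_rpow (-l)
  have := continuousOn_chordSq_rpow (-l - 1)
  have := continuousOn_chordSq_rpow (-l - 2)
  unfold zonalPoissonKernelDeriv₂
  fun_prop

/- Harmonicity of the Poisson kernel: the terms are `s² ∂ₛ²`, `(2l - 1) s ∂ₛ` and the spherical
Laplacian `(1 - t²) ∂ₜ² - (2l - 1) t ∂ₜ` applied to it. -/
theorem zonalPoissonKernel_harmonic {l s t : ℝ} (h : 0 < chordSq s t) :
    s ^ 2 * zonalPoissonKernelDeriv₂ l s t + (2 * l - 1) * s * zonalPoissonKernelDeriv l s t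
      + ((1 - t ^ 2) * ((1 - s ^ 2) * (4 * l * (l + 1) * s ^ 2) * chordSq s t ^ (-l - 2))
        - (2 * l - 1) * t * ((1 - s ^ 2) * (2 * l * s) * chordSq s t ^ (-l - 1))) = 0 := by
  have rpow_sub_one : chordSq s t ^ (-l - 1) = chordSq s t * chordSq s t ^ (-l - 2) := by
    rw [mul_comm, ← Real.rpow_add_one h.ne']; congr 1; ring
  have rpow_neg : chordSq s t ^ (-l) = chordSq s t ^ 2 * chordSq s t ^ (-l - 2) := by
    rw [mul_comm, ← Real.rpow_add_natCast h.ne']; congr 1; push_cast; ring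
  unfold zonalPoissonKernelDeriv₂ zonalPoissonKernelDeriv
  rw [rpow_neg, rpow_sub_one]
  unfold chordSq
  ring

end PoissonKernel

section CauchyEuler

theorem eq_of_hasDerivAt_zero {f : ℝ → ℝ} {a b : ℝ} (hab : a < b)
    (hcont : ContinuousOn f (Icc a b)) (hf : ∀ x ∈ Ioo a b, HasDerivAt f 0 x) : f a = f b := by
  obtain ⟨c, -, h⟩ := exists_hasDerivAt_eq_slope f (fun _ => 0) hab hcont hf
  rcases div_eq_zero_iff.1 h.symm with h | h <;> linarith

variable {F F' F'' : ℝ → ℝ} {j m : ℕ}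

/- The roots of the indicial equation are `j` and `-(j + m)`: regularity at `0` rules out the
second one. -/
theorem mul_eq_of_cauchyEuler (hF : ∀ s ∈ Ioo (-1 : ℝ) 1, HasDerivAt F (F' s) s)
    (hF' : ∀ s ∈ Ioo (-1 : ℝ) 1, HasDerivAt F' (F'' s) s)
    (ode : ∀ s ∈ Ioo (-1 : ℝ) 1, s ^ 2 * F'' s + (m + 1) * s * F' s = j * (j + m) * F s)
    {s : ℝ} (hs : s ∈ Ioo (0 : ℝ) 1) : s * F' s = j * F s := by
  have hasDerivAt_mul_sub : ∀ x ∈ Ioo (-1 : ℝ) 1,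
      HasDerivAt (fun x => x ^ (j + m) * (x * F' x - j * F x)) _ x := fun x hx =>
    (hasDerivAt_pow (j + m) x).mul
      (((hasDerivAt_id' x).mul (hF' x hx)).sub ((hF x hx).const_mul (j : ℝ)))
  have const : (0 : ℝ) ^ (j + m) * (0 * F' 0 - j * F 0) = s ^ (j + m) * (s * F' s - j * F s) := by
    refine eq_of_hasDerivAt_zero (f := fun x => x ^ (j + m) * (x * F' x - j * F x)) hs.1
      (fun x hx => ?_) fun x hx => ?_
    · exact (hasDerivAt_mul_sub x
        ⟨by linarith [hx.1], hx.2.trans_lt hs.2⟩).continuousAt.continuousWithinAt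
    · have hx' : x ∈ Ioo (-1 : ℝ) 1 := ⟨by linarith [hx.1], hx.2.trans hs.2⟩
      refine (hasDerivAt_mul_sub x hx').congr_deriv ?_
      have pow_eq : x * ((j + m : ℕ) * x ^ (j + m - 1)) = (j + m) * x ^ (j + m) := by
        rcases (j + m).eq_zero_or_pos with h | h
        · simp [h, ← Nat.cast_add]
        · rw [mul_left_comm, mul_pow_sub_one h.ne', Nat.cast_add]
      refine mul_left_cancel₀ hx.1.ne' ?_
      linear_combination (x * F' x - j * F x) * pow_eq + x ^ (j + m) * ode x hx'
  have zero_eq : (0 : ℝ) ^ (j + m) * (0 * F' 0 - j * F 0) = 0 := by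
    rcases j.eq_zero_or_pos with h | h
    · simp [h]
    · simp [h.ne']
  exact sub_eq_zero.1 ((mul_eq_zero.1 (const.symm.trans zero_eq)).resolve_left
    (pow_pos hs.1 _).ne')

theorem div_pow_eq_of_cauchyEuler (hF : ∀ s ∈ Ioo (-1 : ℝ) 1, HasDerivAt F (F' s) s)
    (hF' : ∀ s ∈ Ioo (-1 : ℝ) 1, HasDerivAt F' (F'' s) s)
    (ode : ∀ s ∈ Ioo (-1 : ℝ) 1, s ^ 2 * F'' s + (m + 1) * s * F' s = j * (j + m) * F s)
    {s r : ℝ} (hs : 0 < s) (hsr : s < r) (hr : r < 1) : F s / s ^ j = F r / r ^ j := by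
  have hasDerivAt_div : ∀ x ∈ Ioo (0 : ℝ) 1, HasDerivAt (fun x => F x / x ^ j) 0 x := by
    intro x hx
    have pow_eq : x * (j * x ^ (j - 1)) = j * x ^ j := by
      rcases j.eq_zero_or_pos with h | h
      · simp [h]
      · rw [mul_left_comm, mul_pow_sub_one h.ne']
    refine ((hF x ⟨by linarith [hx.1], hx.2⟩).div (hasDerivAt_pow j x)
      (pow_ne_zero j hx.1.ne')).congr_deriv (div_eq_zero_iff.2 (.inl ?_))
    refine mul_left_cancel₀ hx.1.ne' ?_
    linear_combination x ^ j * mul_eq_of_cauchyEuler hF hF' ode hx - F x * pow_eq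
  exact eq_of_hasDerivAt_zero hsr (fun x hx => (hasDerivAt_div x ⟨hs.trans_le hx.1,
    hx.2.trans_lt hr⟩).continuousAt.continuousWithinAt)
    fun x hx => hasDerivAt_div x ⟨hs.trans hx.1, hx.2.trans hr⟩

end CauchyEuler

section PoissonIntegral

open Metric Module InnerProductSpace Filter Topology
open scoped RealInnerProductSpace

variable {E : Type*} [NormedAddCommGroup E] [InnerProductSpace ℝ E]

theorem tendstoUniformlyOn_zonalPoissonKernel {l : ℝ} (hl : 0 ≤ l) (ζ : sphere (0 : E) 1)
    {u : Set (sphere (0 : E) 1)} (hu : IsOpen u) (hζ : ζ ∈ u) :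
    TendstoUniformlyOn (fun s (ξ : sphere (0 : E) 1) => zonalPoissonKernel l s ⟪(ζ : E), ξ⟫) 0
      (𝓝[<] 1) uᶜ := by
  obtain ⟨δ, hδ, hball⟩ := Metric.isOpen_iff.1 hu ζ hζ
  have le_chordSq {s : ℝ} (hs : 0 ≤ s) {ξ : sphere (0 : E) 1} (hξ : ξ ∈ uᶜ) :
      s * δ ^ 2 ≤ chordSq s ⟪(ζ : E), ξ⟫ := by
    have norm_sq : ‖(ζ : E) - ξ‖ ^ 2 = 2 - 2 * ⟪(ζ : E), ξ⟫ := by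
      rw [norm_sub_sq_real, norm_eq_of_mem_sphere, norm_eq_of_mem_sphere]; ring
    have le_norm : δ ≤ ‖(ζ : E) - ξ‖ := by
      rw [← dist_eq_norm, dist_comm]
      exact not_lt.1 fun h => hξ (hball h)
    have := pow_le_pow_left₀ hδ.le le_norm 2
    unfold chordSq
    nlinarith [sq_nonneg (1 - s)]
  have tendsto_bound : Tendsto (fun s : ℝ => (1 - s ^ 2) * (s * δ ^ 2) ^ (-l)) (𝓝[<] 1) (𝓝 0) := by
    have : ContinuousAt (fun s : ℝ => (1 - s ^ 2) * (s * δ ^ 2) ^ (-l)) 1 :=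
      ContinuousAt.mul (by fun_prop) (ContinuousAt.rpow_const (by fun_prop) (.inl (by positivity)))
    simpa using this.tendsto.mono_left nhdsWithin_le_nhds
  refine Metric.tendstoUniformlyOn_iff.2 fun ε hε => ?_
  filter_upwards [tendsto_bound.eventually_lt_const hε, Ioo_mem_nhdsLT zero_lt_one]
    with s bound_lt hs ξ hξ
  have hs' : s ∈ Ioo (-1 : ℝ) 1 := ⟨by linarith [hs.1], hs.2⟩
  rw [Pi.zero_apply, dist_zero_left, Real.norm_eq_abs, abs_of_nonneg (zonalPoissonKernel_nonneg l
    hs' (real_inner_mem_Icc_of_mem_sphere ζ ξ.2))]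
  refine lt_of_le_of_lt (mul_le_mul_of_nonneg_left ?_ (by nlinarith [hs.1, hs.2])) bound_lt
  exact Real.rpow_le_rpow_of_nonpos (by have := hs.1; positivity) (le_chordSq hs.1.le hξ) (by simpa)

variable [FiniteDimensional ℝ E] [MeasurableSpace E] [BorelSpace E]

/-- The Poisson integral over the unit sphere of a function `p`, evaluated at the point `s ζ` of the
unit ball. It is not normalized: the Poisson integral of `1` is the area of the sphere. -/
def poissonIntegral (p : E → ℝ) (ζ : sphere (0 : E) 1) (s : ℝ) : ℝ :=
  ∫ ξ : sphere (0 : E) 1, zonalPoissonKernel (finrank ℝ E / 2) s ⟪(ζ : E), ξ⟫ * p ξ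
    ∂volume.toSphere

/-- The radial derivative of `poissonIntegral`. -/
def poissonIntegralDeriv (p : E → ℝ) (ζ : sphere (0 : E) 1) (s : ℝ) : ℝ :=
  ∫ ξ : sphere (0 : E) 1, zonalPoissonKernelDeriv (finrank ℝ E / 2) s ⟪(ζ : E), ξ⟫ * p ξ
    ∂volume.toSphere

/-- The second radial derivative of `poissonIntegral`. -/
def poissonIntegralDeriv₂ (p : E → ℝ) (ζ : sphere (0 : E) 1) (s : ℝ) : ℝ :=
  ∫ ξ : sphere (0 : E) 1, zonalPoissonKernelDeriv₂ (finrank ℝ E / 2) s ⟪(ζ : E), ξ⟫ * p ξ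
    ∂volume.toSphere

variable {p : E → ℝ} {j : ℕ} (ζ : sphere (0 : E) 1) {s : ℝ}

theorem hasDerivAt_poissonIntegral (hp : ContinuousOn p (sphere 0 1)) (hs : s ∈ Ioo (-1 : ℝ) 1) :
    HasDerivAt (poissonIntegral p ζ) (poissonIntegralDeriv p ζ s) s :=
  hasDerivAt_integral_zonal_mul ζ hp
    (fun _ hs _ ht => hasDerivAt_zonalPoissonKernel (chordSq_pos hs ht))
    (fun _ hs => continuousOn_zonalPoissonKernel _ hs) (continuousOn_zonalPoissonKernelDeriv _) hs

theorem hasDerivAt_poissonIntegralDeriv (hp : ContinuousOn p (sphere 0 1))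
    (hs : s ∈ Ioo (-1 : ℝ) 1) :
    HasDerivAt (poissonIntegralDeriv p ζ) (poissonIntegralDeriv₂ p ζ s) s :=
  hasDerivAt_integral_zonal_mul ζ hp
    (fun _ hs _ ht => hasDerivAt_zonalPoissonKernelDeriv (chordSq_pos hs ht))
    (fun s hs => (continuousOn_zonalPoissonKernelDeriv _).comp (f := fun t => (s, t))
      (by fun_prop) fun _ ht => ⟨hs, ht⟩)
    (continuousOn_zonalPoissonKernelDeriv₂ _) hs

theorem IsSolidHarmonic.poissonIntegral_ode (hp : IsSolidHarmonic j p) (hs : s ∈ Ioo (-1 : ℝ) 1) :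
    s ^ 2 * poissonIntegralDeriv₂ p ζ s + (finrank ℝ E - 1) * s * poissonIntegralDeriv p ζ s =
      j * (j + finrank ℝ E - 2) * poissonIntegral p ζ s := by
  have hp_cont : ContinuousOn p (sphere 0 1) := hp.contDiff.continuous.continuousOn
  set l : ℝ := finrank ℝ E / 2 with hl
  have gegenbauer := hp.integral_toSphere_gegenbauer ζ (g := zonalPoissonKernel l s)
    (g' := fun t => (1 - s ^ 2) * (2 * l * s) * chordSq s t ^ (-l - 1))
    (g'' := fun t => (1 - s ^ 2) * (4 * l * (l + 1) * s ^ 2) * chordSq s t ^ (-l - 2))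
    (fun t ht => ((hasDerivAt_chordSq_rpow_right (l := -l) (chordSq_pos hs ht)).const_mul
      (1 - s ^ 2)).congr_deriv (by ring))
    (fun t ht => ((hasDerivAt_chordSq_rpow_right (l := -l - 1) (chordSq_pos hs ht)).const_mul
      ((1 - s ^ 2) * (2 * l * s))).congr_deriv (by rw [show -l - 1 - 1 = -l - 2 by ring]; ring))
    (continuousOn_const.mul (continuousOn_chordSq_rpow_right _ hs))
  have continuousOn_slice {h : ℝ × ℝ → ℝ} (hh : ContinuousOn h (Ioo (-1) 1 ×ˢ Icc (-1) 1)) :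
      ContinuousOn (fun t => h (s, t)) (Icc (-1) 1) :=
    hh.comp (by fun_prop) fun _ ht => ⟨hs, ht⟩
  have integrable_deriv := integrable_zonal_mul ζ
    (continuousOn_slice (continuousOn_zonalPoissonKernelDeriv l)) hp_cont
  have integrable_deriv₂ := integrable_zonal_mul ζ
    (continuousOn_slice (continuousOn_zonalPoissonKernelDeriv₂ l)) hp_cont
  rw [eq_comm, poissonIntegral, ← hl, ← neg_inj, ← neg_mul, ← gegenbauer, poissonIntegralDeriv,
    poissonIntegralDeriv₂, ← hl, ← integral_const_mul, ← integral_const_mul,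
    ← integral_add (integrable_deriv₂.const_mul _) (integrable_deriv.const_mul _), ← integral_neg]
  refine integral_congr_ae (.of_forall fun ξ => ?_)
  have harmonic := zonalPoissonKernel_harmonic (l := l)
    (chordSq_pos hs (real_inner_mem_Icc_of_mem_sphere ζ ξ.2))
  have finrank_eq : (finrank ℝ E : ℝ) = 2 * l := by rw [hl]; ring
  beta_reduce
  rw [finrank_eq]
  linear_combination p ξ * harmonic

theorem IsSolidHarmonic.poissonIntegral_div_pow (hE : 2 ≤ finrank ℝ E) (hp : IsSolidHarmonic j p)
    {r : ℝ} (hs : 0 < s) (hsr : s < r) (hr : r < 1) :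
    poissonIntegral p ζ s / s ^ j = poissonIntegral p ζ r / r ^ j := by
  obtain ⟨m, hm⟩ := Nat.exists_eq_add_of_le hE
  have hp_cont : ContinuousOn p (sphere 0 1) := hp.contDiff.continuous.continuousOn
  refine div_pow_eq_of_cauchyEuler (m := m) (fun _ => hasDerivAt_poissonIntegral ζ hp_cont)
    (fun _ => hasDerivAt_poissonIntegralDeriv ζ hp_cont) (fun x hx => ?_) hs hsr hr
  have ode := hp.poissonIntegral_ode ζ hx
  rw [hm] at ode
  push_cast at ode
  linear_combination ode

theorem poissonIntegral_one (hE : 2 ≤ finrank ℝ E) (hs : s ∈ Ioo (0 : ℝ) 1) :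
    poissonIntegral (fun _ : E => 1) ζ s = (volume : Measure E).toSphere.real univ := by
  have at_zero : poissonIntegral (fun _ : E => 1) ζ 0 =
      (volume : Measure E).toSphere.real univ := by
    simp [poissonIntegral, zonalPoissonKernel, chordSq]
  have tendsto_zero : Tendsto (poissonIntegral (fun _ : E => 1) ζ) (𝓝[>] 0)
      (𝓝 (poissonIntegral (fun _ : E => 1) ζ 0)) :=
    (hasDerivAt_poissonIntegral ζ continuousOn_const
      (by norm_num)).continuousAt.tendsto.mono_left nhdsWithin_le_nhds
  rw [← at_zero]
  refine tendsto_nhds_unique (tendsto_const_nhds.congr' ?_) tendsto_zero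
  filter_upwards [Ioo_mem_nhdsGT hs.1] with r hr
  simpa using (isSolidHarmonic_one.poissonIntegral_div_pow ζ hE hr.1 hr.2 hs.2).symm

theorem tendsto_poissonIntegral (hE : 2 ≤ finrank ℝ E) (hp : ContinuousOn p (sphere 0 1)) :
    Tendsto (poissonIntegral p ζ) (𝓝[<] 1)
      (𝓝 ((volume : Measure E).toSphere.real univ * p ζ)) := by
  have : Nontrivial E := nontrivial_of_finrank_pos (by omega : 0 < finrank ℝ E)
  set μ := (volume : Measure E).toSphere
  set K : ℝ → sphere (0 : E) 1 → ℝ :=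
    fun s ξ => zonalPoissonKernel (finrank ℝ E / 2) s ⟪(ζ : E), ξ⟫
  have area_ne_zero : μ.real univ ≠ 0 := by
    rw [measureReal_ne_zero_iff]
    exact (Measure.measure_univ_ne_zero.2 (Measure.toSphere_ne_zero volume))
  have eventually_mem : ∀ᶠ s in 𝓝[<] (1 : ℝ), s ∈ Ioo (0 : ℝ) 1 := Ioo_mem_nhdsLT zero_lt_one
  have mem_of_mem {s : ℝ} (hs : s ∈ Ioo (0 : ℝ) 1) : s ∈ Ioo (-1 : ℝ) 1 :=
    ⟨by linarith [hs.1], hs.2⟩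
  have peak := tendsto_integral_peak_smul_of_integrable_of_tendsto (μ := μ) (t := univ) (x₀ := ζ)
    (a := p ζ) (g := fun ξ => p ξ) (l := 𝓝[<] (1 : ℝ)) (φ := fun s ξ => (μ.real univ)⁻¹ * K s ξ)
    .univ univ_mem (measure_ne_top _ _) ?_ (fun u hu hζu => ?_) ?_ ?_
    (integrable_toSphere_of_continuousOn hp)
    (continuousOn_iff_continuous_domRestrict.1 hp).continuousAt.tendsto
  · refine (peak.const_mul (μ.real univ)).congr fun s => ?_
    simp only [smul_eq_mul, mul_assoc, integral_const_mul, mul_inv_cancel_left₀ area_ne_zero]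
    rfl
  · filter_upwards [eventually_mem] with s hs ξ
    exact mul_nonneg (by positivity) (zonalPoissonKernel_nonneg _ (mem_of_mem hs)
      (real_inner_mem_Icc_of_mem_sphere ζ ξ.2))
  · simpa [Function.comp_def, Pi.zero_def] using! (uniformContinuous_const_smul
      (μ.real univ)⁻¹).comp_tendstoUniformlyOn (tendstoUniformlyOn_zonalPoissonKernel
        (l := finrank ℝ E / 2) (by positivity) ζ hu hζu)
  · refine tendsto_const_nhds.congr' ?_
    filter_upwards [eventually_mem] with s hs
    have := poissonIntegral_one ζ hE hs
    simp only [poissonIntegral, mul_one] at this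
    rw [setIntegral_univ, integral_const_mul, this, inv_mul_cancel₀ area_ne_zero]
  · filter_upwards [eventually_mem] with s hs
    exact (integrable_toSphere_of_continuousOn (continuousOn_zonal ζ
      (continuousOn_zonalPoissonKernel _ (mem_of_mem hs)))).aestronglyMeasurable.const_mul _

theorem IsSolidHarmonic.poissonIntegral_eq (hE : 2 ≤ finrank ℝ E) (hp : IsSolidHarmonic j p)
    (hs : s ∈ Ioo (0 : ℝ) 1) :
    poissonIntegral p ζ s = (volume : Measure E).toSphere.real univ * s ^ j * p ζ := by
  have tendsto_div : Tendsto (fun r => poissonIntegral p ζ r / r ^ j) (𝓝[<] 1)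
      (𝓝 ((volume : Measure E).toSphere.real univ * p ζ / 1 ^ j)) :=
    (tendsto_poissonIntegral ζ hE hp.contDiff.continuous.continuousOn).div
      ((continuous_pow j).tendsto' 1 _ rfl |>.mono_left nhdsWithin_le_nhds) (by simp)
  have div_eq : poissonIntegral p ζ s / s ^ j =
      (volume : Measure E).toSphere.real univ * p ζ / 1 ^ j := by
    refine tendsto_nhds_unique (tendsto_const_nhds.congr' ?_) tendsto_div
    filter_upwards [Ioo_mem_nhdsLT hs.2] with r hr
    exact hp.poissonIntegral_div_pow ζ hE hs.1 hr.1 hr.2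
  rw [div_eq_iff (pow_ne_zero j hs.1.ne')] at div_eq
  rw [div_eq]
  ring

end PoissonIntegral

section HarmonicPolynomial

open InnerProductSpace MvPolynomial

variable {ι : Type*} [Fintype ι]

theorem contDiff_eval_mvPolynomial (q : MvPolynomial ι ℝ) {k : WithTop ℕ∞} :
    ContDiff ℝ k fun x : EuclideanSpace ℝ ι => eval x.ofLp q := by
  induction q using MvPolynomial.induction_on with
  | C a => simpa using contDiff_const
  | add p q hp hq => simpa using hp.add hq
  | mul_X p i hp =>
    simpa using hp.mul (EuclideanSpace.proj (𝕜 := ℝ) i : EuclideanSpace ℝ ι →L[ℝ] ℝ).contDiff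

theorem hasFDerivAt_eval_mvPolynomial (q : MvPolynomial ι ℝ) (x : EuclideanSpace ℝ ι) :
    HasFDerivAt (fun x : EuclideanSpace ℝ ι => eval x.ofLp q)
      (∑ i, eval x.ofLp (pderiv i q) • (EuclideanSpace.proj i : EuclideanSpace ℝ ι →L[ℝ] ℝ)) x := by
  classical
  induction q using MvPolynomial.induction_on with
  | C a => simpa using hasFDerivAt_const a x
  | add p q hp hq => simpa [add_smul, Finset.sum_add_distrib] using! hp.add hq
  | mul_X p i hp =>
    have := hp.mul (EuclideanSpace.proj (𝕜 := ℝ) i : EuclideanSpace ℝ ι →L[ℝ] ℝ).hasFDerivAt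
    simp only [map_mul, eval_X]
    refine this.congr_fderiv ?_
    ext v
    simp [pderiv_X, Pi.single_apply, Finset.mul_sum, Finset.sum_add_distrib, mul_add,
      mul_left_comm, apply_ite, mul_comm]

theorem fderiv_eval_mvPolynomial_single {n : ℕ} (q : MvPolynomial (Fin n) ℝ) (i : Fin n)
    (x : EuclideanSpace ℝ (Fin n)) :
    fderiv ℝ (fun x : EuclideanSpace ℝ (Fin n) => eval x.ofLp q) x (EuclideanSpace.single i 1) =
      eval x.ofLp (pderiv i q) := by
  simp [(hasFDerivAt_eval_mvPolynomial q x).fderiv]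

open scoped Laplacian in
theorem laplacian_eval_mvPolynomial {n : ℕ} (q : MvPolynomial (Fin n) ℝ)
    (x : EuclideanSpace ℝ (Fin n)) :
    Δ (fun x : EuclideanSpace ℝ (Fin n) => eval x.ofLp q) x = eval x.ofLp (polyLaplacian n q) := by
  have differentiable_fderiv : Differentiable ℝ
      (fderiv ℝ fun x : EuclideanSpace ℝ (Fin n) => eval x.ofLp q) :=
    ((contDiff_eval_mvPolynomial q).fderiv_right (m := 1) (n := 2) (by norm_num)).differentiable
      one_ne_zero
  rw [laplacian_eq_sum_fderiv_fderiv (EuclideanSpace.basisFun (Fin n) ℝ)]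
  simp only [polyLaplacian, LinearMap.sum_apply, map_sum]
  refine Finset.sum_congr rfl fun i _ => ?_
  have fderiv_fderiv := congrArg (· (EuclideanSpace.single i (1 : ℝ)))
    (fderiv_clm_apply (differentiable_fderiv x)
      (differentiableAt_const (EuclideanSpace.single i (1 : ℝ))))
  simpa [fderiv_eval_mvPolynomial_single] using fderiv_fderiv.symm

theorem eval_smul_of_isHomogeneous {σ R : Type*} [CommSemiring R] {j : ℕ} {q : MvPolynomial σ R}
    (hq : q.IsHomogeneous j) (r : R) (x : σ → R) : eval (r • x) q = r ^ j * eval x q := by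
  rw [eval_eq, eval_eq, Finset.mul_sum]
  refine Finset.sum_congr rfl fun m hm => ?_
  have degree_eq : m.degree = j := not_imp_comm.1 hq.coeff_eq_zero (mem_support_iff.1 hm)
  simp only [Pi.smul_apply, smul_eq_mul, mul_pow, Finset.prod_mul_distrib,
    Finset.prod_pow_eq_pow_sum, ← degree_eq, Finsupp.degree_apply]
  ring

theorem isSolidHarmonic_eval_mvPolynomial {n j : ℕ} {q : MvPolynomial (Fin n) ℝ}
    (hq : q.IsHomogeneous j) (laplacian_eq_zero : polyLaplacian n q = 0) :
    IsSolidHarmonic j fun x : EuclideanSpace ℝ (Fin n) => eval x.ofLp q where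
  harmonicOnNhd x _ := ⟨(contDiff_eval_mvPolynomial q).contDiffAt, .of_forall fun y => by
    simp [laplacian_eval_mvPolynomial, laplacian_eq_zero]⟩
  apply_smul r x := eval_smul_of_isHomogeneous hq r x.ofLp

theorem exists_isSolidHarmonic_of_mem_sphHarm {n j : ℕ} {Y : USphere n → ℝ} (hY : Y ∈ sphHarm n j) :
    ∃ p : EuclideanSpace ℝ (Fin n) → ℝ, IsSolidHarmonic j p ∧ ∀ ξ : USphere n, Y ξ = p ξ := by
  obtain ⟨q, ⟨homogeneous, laplacian_eq_zero⟩, rfl⟩ := hY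
  exact ⟨_, isSolidHarmonic_eval_mvPolynomial homogeneous laplacian_eq_zero, fun ξ => rfl⟩

end HarmonicPolynomial

section PolarCoordinates

open Metric Module ENNReal

variable {E : Type*} [NormedAddCommGroup E] [NormedSpace ℝ E] [FiniteDimensional ℝ E]
  [Nontrivial E] [MeasurableSpace E] [BorelSpace E] (μ : Measure E) [μ.IsAddHaarMeasure]

theorem lintegral_eq_lintegral_toSphere {f : E → ℝ≥0∞} (hf : Measurable f) :
    ∫⁻ x, f x ∂μ = ∫⁻ ξ : sphere (0 : E) 1, (∫⁻ r in Ioi (0 : ℝ),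
      ENNReal.ofReal (r ^ (finrank ℝ E - 1)) * f (r • (ξ : E))) ∂μ.toSphere := by
  have measurable_smul : Measurable fun p : sphere (0 : E) 1 × Ioi (0 : ℝ) =>
      f ((p.2 : ℝ) • (p.1 : E)) := hf.comp (by fun_prop)
  have inner_eq (ξ : sphere (0 : E) 1) :
      ∫⁻ r, f ((r : ℝ) • (ξ : E)) ∂Measure.volumeIoiPow (finrank ℝ E - 1) =
        ∫⁻ r in Ioi (0 : ℝ), ENNReal.ofReal (r ^ (finrank ℝ E - 1)) * f (r • (ξ : E)) := by
    rw [Measure.volumeIoiPow,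
      lintegral_withDensity_eq_lintegral_mul _ (by fun_prop)
        (g := fun r : Ioi (0 : ℝ) => f ((r : ℝ) • (ξ : E))) (hf.comp (by fun_prop))]
    exact lintegral_subtype_comap measurableSet_Ioi fun r : ℝ =>
      ENNReal.ofReal (r ^ (finrank ℝ E - 1)) * f (r • (ξ : E))
  calc ∫⁻ x, f x ∂μ = ∫⁻ x : ({0}ᶜ : Set E), f x ∂μ.comap (↑) := by
        rw [lintegral_subtype_comap (measurableSet_singleton _).compl, restrict_compl_singleton]
    _ = ∫⁻ p, f ((p.2 : ℝ) • (p.1 : E))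
          ∂μ.toSphere.prod (Measure.volumeIoiPow (finrank ℝ E - 1)) := by
        rw [← μ.measurePreserving_homeomorphUnitSphereProd.lintegral_comp measurable_smul]
        refine lintegral_congr fun x => ?_
        simp [smul_smul, norm_ne_zero_iff.2 x.2]
    _ = _ := by
        rw [lintegral_prod _ measurable_smul.aemeasurable]
        exact lintegral_congr inner_eq

theorem toSphere_eq_map_of_lintegral {T : Type*} [MeasurableSpace T] {κ : Measure T}
    {q : T → sphere (0 : E) 1} (hq : Measurable q)
    (h : ∀ f : E → ℝ≥0∞, Measurable f → ∫⁻ x, f x ∂μ = ∫⁻ t, (∫⁻ r in Ioi (0 : ℝ),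
      ENNReal.ofReal (r ^ (finrank ℝ E - 1)) * f (r • (q t : E))) ∂κ) :
    μ.toSphere = κ.map q := by
  ext s hs
  obtain ⟨A, hA, rfl⟩ := hs
  set cone : E → ℝ≥0∞ := fun x =>
    ENNReal.ofReal (‖x‖ ^ (finrank ℝ E - 1))⁻¹ *
      (A.indicator 1 (‖x‖⁻¹ • x) * (ball 0 1).indicator 1 x)
  have measurable_cone : Measurable cone := .mul (by fun_prop) <|
    ((measurable_one.indicator hA).comp (by fun_prop)).mul
      (measurable_one.indicator measurableSet_ball)
  have lintegral_cone (ξ : sphere (0 : E) 1) : ∫⁻ r in Ioi (0 : ℝ),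
      ENNReal.ofReal (r ^ (finrank ℝ E - 1)) * cone (r • (ξ : E)) = A.indicator 1 (ξ : E) := by
    calc _ = ∫⁻ r in Ioi (0 : ℝ), (Iio 1).indicator (fun _ => A.indicator 1 (ξ : E)) r := by
          refine setLIntegral_congr_fun measurableSet_Ioi fun r (hr : 0 < r) => ?_
          have normalize : ‖r • (ξ : E)‖⁻¹ • r • (ξ : E) = ξ := by
            simp [norm_smul, abs_of_pos hr, smul_smul, hr.ne']
          simp only [cone, normalize]
          rw [← mul_assoc, ← ENNReal.ofReal_mul (by positivity)]
          simp [indicator, norm_smul, abs_of_pos hr, hr.ne']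
      _ = _ := by
          rw [lintegral_indicator measurableSet_Iio, setLIntegral_const,
            Measure.restrict_apply measurableSet_Iio, Iio_inter_Ioi, Real.volume_Ioo]
          simp
  have eq := (lintegral_eq_lintegral_toSphere μ measurable_cone).symm.trans (h cone measurable_cone)
  simp only [lintegral_cone] at eq
  rwa [Measure.map_apply hq (measurable_subtype_coe hA),
    ← lintegral_indicator_one (measurable_subtype_coe hA),
    ← lintegral_indicator_one (hq (measurable_subtype_coe hA))]

end PolarCoordinates

section StereographicCoordinates

open Module ENNReal

theorem lintegral_Ioi_comp_mul_left {c : ℝ} (hc : 0 < c) (f : ℝ → ℝ≥0∞) :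
    ∫⁻ r in Ioi (0 : ℝ), f r = ∫⁻ R in Ioi (0 : ℝ), ENNReal.ofReal c * f (c * R) := by
  have image_eq : (c * ·) '' Ioi (0 : ℝ) = Ioi 0 := by
    simpa using image_mul_left_Ioi hc 0
  conv_lhs => rw [← image_eq]
  exact lintegral_image_eq_lintegral_deriv_mul_of_monotoneOn measurableSet_Ioi
    (fun R _ => (hasDerivAt_const_mul c).hasDerivWithinAt)
    ((monotone_mul_left_of_nonneg hc.le).monotoneOn _) f

theorem image_sub_inv_Ioi_zero {r : ℝ} (hr : 0 < r) :
    (fun ρ : ℝ => r / 2 * (ρ - ρ⁻¹)) '' Ioi 0 = univ := by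
  refine eq_univ_of_forall fun t => ⟨(t + √(t ^ 2 + r ^ 2)) / r, ?_, ?_⟩
  all_goals
    have sq_sqrt : √(t ^ 2 + r ^ 2) ^ 2 = t ^ 2 + r ^ 2 := Real.sq_sqrt (by positivity)
    have add_sqrt_pos : 0 < t + √(t ^ 2 + r ^ 2) :=
      neg_lt_iff_pos_add.mp (Real.neg_sqrt_lt_of_sq_lt (lt_add_of_pos_right _ (by positivity)))
  · exact div_pos add_sqrt_pos hr
  · field_simp
    linear_combination sq_sqrt

theorem lintegral_comp_sub_inv {r : ℝ} (hr : 0 < r) (f : ℝ → ℝ≥0∞) :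
    ∫⁻ t, f t = ∫⁻ ρ in Ioi (0 : ℝ),
      ENNReal.ofReal (r / 2 * (1 + (ρ ^ 2)⁻¹)) * f (r / 2 * (ρ - ρ⁻¹)) := by
  rw [← setLIntegral_univ, ← image_sub_inv_Ioi_zero hr]
  refine lintegral_image_eq_lintegral_deriv_mul_of_monotoneOn measurableSet_Ioi
    (fun ρ (hρ : 0 < ρ) => ?_) (fun ρ (hρ : 0 < ρ) ρ' _ hle => ?_) f
  · simpa using
      (((hasDerivAt_id ρ).sub (hasDerivAt_inv hρ.ne')).const_mul (r / 2)).hasDerivWithinAt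
  · gcongr

theorem lintegral_halfPlane_stereographic {F : ℝ → ℝ → ℝ≥0∞} (hF : Measurable F.uncurry) :
    ∫⁻ r in Ioi (0 : ℝ), ∫⁻ t, F r t =
      ∫⁻ ρ in Ioi (0 : ℝ), ∫⁻ R in Ioi (0 : ℝ), ENNReal.ofReal (R * (2 / (1 + ρ ^ 2))) *
        F (R * (2 * ρ / (1 + ρ ^ 2))) (R * ((ρ ^ 2 - 1) / (1 + ρ ^ 2))) := by
  calc ∫⁻ r in Ioi (0 : ℝ), ∫⁻ t, F r t
      = ∫⁻ r in Ioi (0 : ℝ), ∫⁻ ρ in Ioi (0 : ℝ),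
          ENNReal.ofReal (r / 2 * (1 + (ρ ^ 2)⁻¹)) * F r (r / 2 * (ρ - ρ⁻¹)) :=
        setLIntegral_congr_fun measurableSet_Ioi fun r hr => lintegral_comp_sub_inv hr _
    _ = ∫⁻ ρ in Ioi (0 : ℝ), ∫⁻ r in Ioi (0 : ℝ),
          ENNReal.ofReal (r / 2 * (1 + (ρ ^ 2)⁻¹)) * F r (r / 2 * (ρ - ρ⁻¹)) :=
        lintegral_lintegral_swap <| Measurable.aemeasurable <|
          .mul (by fun_prop) (hF.comp (g := F.uncurry)
            (f := fun p : ℝ × ℝ => (p.1, p.1 / 2 * (p.2 - p.2⁻¹))) (by fun_prop))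
    _ = _ := by
        refine setLIntegral_congr_fun measurableSet_Ioi fun ρ (hρ : 0 < ρ) => ?_
        have scale_pos : 0 < 2 * ρ / (1 + ρ ^ 2) := by positivity
        rw [lintegral_Ioi_comp_mul_left scale_pos]
        refine setLIntegral_congr_fun measurableSet_Ioi fun R _ => ?_
        rw [← mul_assoc, ← ENNReal.ofReal_mul scale_pos.le]
        congr 2 <;> (field_simp; try ring)

variable {n : ℕ}

/-- The point `(v, t)` of `ℝⁿ⁺¹ = ℝⁿ × ℝ`. -/
def snocVec (v : EuclideanSpace ℝ (Fin n)) (t : ℝ) : EuclideanSpace ℝ (Fin (n + 1)) :=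
  WithLp.toLp 2 (Fin.snoc (α := fun _ => ℝ) v.ofLp t)

theorem smul_snocVec (c : ℝ) (v : EuclideanSpace ℝ (Fin n)) (t : ℝ) :
    c • snocVec v t = snocVec (c • v) (c * t) := by
  ext i
  cases i using Fin.lastCases <;> simp [snocVec]

theorem norm_snocVec_sub_snocVec_sq (v w : EuclideanSpace ℝ (Fin n)) (t s : ℝ) :
    ‖snocVec v t - snocVec w s‖ ^ 2 = ‖v - w‖ ^ 2 + (t - s) ^ 2 := by
  simp [EuclideanSpace.norm_sq_eq, Fin.sum_univ_castSucc, snocVec]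

theorem measurePreserving_snocVec :
    MeasurePreserving (fun p : EuclideanSpace ℝ (Fin n) × ℝ => snocVec p.1 p.2)
      (volume.prod volume) volume := by
  have snoc_eq : (fun p : EuclideanSpace ℝ (Fin n) × ℝ => snocVec p.1 p.2) =
      WithLp.toLp 2 ∘ (MeasurableEquiv.piFinSuccAbove (fun _ => ℝ) (Fin.last n)).symm ∘
        Prod.swap ∘ Prod.map WithLp.ofLp id := by
    funext p
    simp [snocVec, MeasurableEquiv.piFinSuccAbove_symm_apply, Fin.insertNthEquiv,
      Fin.insertNth_last']
  rw [snoc_eq]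
  exact (PiLp.volume_preserving_toLp (Fin (n + 1))).comp <|
    (volume_preserving_piFinSuccAbove (fun _ => ℝ) (Fin.last n)).symm.comp <|
      Measure.measurePreserving_swap.comp <|
        (PiLp.volume_preserving_ofLp (Fin n)).prod (.id (volume : Measure ℝ))

end StereographicCoordinates

section StereographicSphere

open Module ENNReal
open scoped RealInnerProductSpace

variable {n : ℕ}

/-- The point of `S^n` whose stereographic projection from the north pole is `r ξ`. -/
def stereoPt (r : ℝ) (ξ : USphere n) : USphere (n + 1) :=
  polarPt (2 * Real.arctan r) ξ

theorem polarPt_eq_stereoPt {θ : ℝ} (hθ : θ ∈ Ioo 0 Real.pi) (ξ : USphere n) :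
    polarPt θ ξ = stereoPt (Real.tan (θ / 2)) ξ := by
  rw [stereoPt, Real.arctan_tan (by linarith [hθ.1, Real.pi_pos]) (by linarith [hθ.2])]
  ring_nf

theorem coe_stereoPt (r : ℝ) (ξ : USphere n) :
    (stereoPt r ξ : EuclideanSpace ℝ (Fin (n + 1))) =
      snocVec ((2 * r / (1 + r ^ 2)) • (ξ : EuclideanSpace ℝ (Fin n)))
        ((r ^ 2 - 1) / (1 + r ^ 2)) := by
  have sin_eq : Real.sin (2 * Real.arctan r) = 2 * r / (1 + r ^ 2) := by
    rw [Real.sin_two_mul, Real.sin_arctan, Real.cos_arctan]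
    field_simp
    rw [Real.sq_sqrt (by positivity)]
  have cos_eq : -Real.cos (2 * Real.arctan r) = (r ^ 2 - 1) / (1 + r ^ 2) := by
    rw [Real.cos_two_mul, Real.cos_sq_arctan]
    field_simp
    ring
  ext i
  cases i using Fin.lastCases <;> simp [stereoPt, polarPt, polarVec, snocVec, sin_eq, cos_eq]

theorem lastCoord_stereoPt (r : ℝ) (ξ : USphere n) :
    lastCoord (stereoPt r ξ) = (r ^ 2 - 1) / (1 + r ^ 2) := by
  simp [lastCoord, coe_stereoPt, snocVec]

theorem lastCoord_stereoPt_sub (a b : ℝ) (ξ ζ : USphere n) :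
    lastCoord (stereoPt a ξ) - lastCoord (stereoPt b ζ) =
      2 * (a ^ 2 - b ^ 2) / ((1 + a ^ 2) * (1 + b ^ 2)) := by
  simp only [lastCoord_stereoPt]
  field_simp
  ring

theorem norm_stereoPt_sub_sq (a b : ℝ) (ξ ζ : USphere n) :
    ‖(stereoPt a ξ : EuclideanSpace ℝ (Fin (n + 1))) - stereoPt b ζ‖ ^ 2 =
      4 * (a ^ 2 + b ^ 2 - 2 * a * b * ⟪(ξ : EuclideanSpace ℝ (Fin n)), ζ⟫) /
        ((1 + a ^ 2) * (1 + b ^ 2)) := by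
  rw [coe_stereoPt, coe_stereoPt, norm_snocVec_sub_snocVec_sq, norm_sub_sq_real, norm_smul,
    norm_smul, norm_eq_of_mem_sphere, norm_eq_of_mem_sphere, real_inner_smul_left,
    real_inner_smul_right, Real.norm_eq_abs, Real.norm_eq_abs, mul_one, mul_one, sq_abs, sq_abs]
  field_simp
  ring

theorem continuous_stereoPt :
    Continuous fun p : ℝ × USphere n => stereoPt p.1 p.2 := by
  refine Continuous.subtype_mk ((PiLp.continuous_toLp 2 _).comp (continuous_pi fun i => ?_)) _
  cases i using Fin.lastCases
  · simp only [Fin.snoc_last]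
    fun_prop
  · simp only [Fin.snoc_castSucc]
    fun_prop

/-- The density of the surface measure of `S^n` in the stereographic polar coordinates `(r, ξ)`:
`dy = stereoDensity n r dr dξ`. -/
def stereoDensity (n : ℕ) (r : ℝ) : ℝ := (2 / (1 + r ^ 2)) ^ n * r ^ (n - 1)

/-- The radial part of the surface measure of `S^n` in stereographic polar coordinates. -/
def stereoRadial (n : ℕ) : Measure ℝ :=
  (volume.restrict (Ioi 0)).withDensity fun r => ENNReal.ofReal (stereoDensity n r)

theorem measurable_stereoDensity : Measurable (stereoDensity n) := by
  unfold stereoDensity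
  fun_prop

theorem stereoDensity_nonneg {r : ℝ} (hr : 0 ≤ r) : 0 ≤ stereoDensity n r := by
  unfold stereoDensity
  positivity

theorem lintegral_stereoRadial {f : ℝ → ℝ≥0∞} (hf : Measurable f) :
    ∫⁻ r, f r ∂stereoRadial n =
      ∫⁻ r in Ioi (0 : ℝ), ENNReal.ofReal (stereoDensity n r) * f r :=
  lintegral_withDensity_eq_lintegral_mul _ measurable_stereoDensity.ennreal_ofReal hf

instance : SFinite (stereoRadial n) := by unfold stereoRadial; infer_instance

instance : IsFiniteMeasure (surf n) := by unfold surf; infer_instance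

theorem lintegral_ray_stereographic {f : EuclideanSpace ℝ (Fin (n + 1)) → ℝ≥0∞}
    (hf : Measurable f) (hn : 1 ≤ n) (ξ : USphere n) :
    ∫⁻ r in Ioi (0 : ℝ), ENNReal.ofReal (r ^ (n - 1)) *
        ∫⁻ t, f (snocVec (r • (ξ : EuclideanSpace ℝ (Fin n))) t) =
      ∫⁻ ρ in Ioi (0 : ℝ), ENNReal.ofReal (stereoDensity n ρ) *
        ∫⁻ R in Ioi (0 : ℝ), ENNReal.ofReal (R ^ n) *
          f (R • (stereoPt ρ ξ : EuclideanSpace ℝ (Fin (n + 1)))) := by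
  have measurable_f_snoc : Measurable fun p : ℝ × ℝ =>
      f (snocVec (p.1 • (ξ : EuclideanSpace ℝ (Fin n))) p.2) :=
    hf.comp (measurePreserving_snocVec.measurable.comp (f := fun p : ℝ × ℝ =>
      (p.1 • (ξ : EuclideanSpace ℝ (Fin n)), p.2)) (by fun_prop))
  calc _ = ∫⁻ r in Ioi (0 : ℝ), ∫⁻ t, ENNReal.ofReal (r ^ (n - 1)) *
        f (snocVec (r • (ξ : EuclideanSpace ℝ (Fin n))) t) :=
        lintegral_congr fun r => (lintegral_const_mul _
          (measurable_f_snoc.comp measurable_prodMk_left)).symm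
    _ = _ := lintegral_halfPlane_stereographic
        (F := fun r t => ENNReal.ofReal (r ^ (n - 1)) *
          f (snocVec (r • (ξ : EuclideanSpace ℝ (Fin n))) t))
        (.mul (by fun_prop) measurable_f_snoc)
    _ = _ := by
        refine setLIntegral_congr_fun measurableSet_Ioi fun ρ (hρ : 0 < ρ) => ?_
        have measurable_ray : Measurable fun R : ℝ => ENNReal.ofReal (R ^ n) *
            f (R • (stereoPt ρ ξ : EuclideanSpace ℝ (Fin (n + 1)))) :=
          .mul (by fun_prop) (hf.comp (by fun_prop))
        rw [← lintegral_const_mul _ measurable_ray]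
        refine setLIntegral_congr_fun measurableSet_Ioi fun R (hR : 0 < R) => ?_
        rw [coe_stereoPt, smul_snocVec, smul_smul, ← mul_assoc, ← mul_assoc,
          ← ENNReal.ofReal_mul (by positivity),
          ← ENNReal.ofReal_mul (stereoDensity_nonneg hρ.le)]
        congr 2
        obtain ⟨m, rfl⟩ := Nat.exists_eq_add_of_le' hn
        simp only [stereoDensity, Nat.add_sub_cancel, mul_pow, div_pow, pow_succ]
        field_simp

theorem surf_eq_map_stereoPt (hn : 1 ≤ n) :
    surf (n + 1) = ((stereoRadial n).prod (surf n)).map fun p => stereoPt p.1 p.2 := by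
  have : Nonempty (Fin n) := ⟨⟨0, hn⟩⟩
  refine toSphere_eq_map_of_lintegral volume continuous_stereoPt.measurable fun f hf => ?_
  have measurable_f_snoc : Measurable fun p : EuclideanSpace ℝ (Fin n) × ℝ =>
      f (snocVec p.1 p.2) := hf.comp measurePreserving_snocVec.measurable
  have measurable_f_fiber : Measurable fun v : EuclideanSpace ℝ (Fin n) =>
      ∫⁻ t, f (snocVec v t) := measurable_f_snoc.lintegral_prod_right'
  have measurable_radial : Measurable fun p : ℝ × USphere n => ∫⁻ R in Ioi (0 : ℝ),
      ENNReal.ofReal (R ^ n) * f (R • (stereoPt p.1 p.2 : EuclideanSpace ℝ (Fin (n + 1)))) :=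
    Measurable.lintegral_prod_right' (f := fun q : (ℝ × USphere n) × ℝ =>
      ENNReal.ofReal (q.2 ^ n) * f (q.2 • (stereoPt q.1.1 q.1.2 : EuclideanSpace ℝ (Fin (n + 1)))))
      (.mul (by fun_prop) (hf.comp (measurable_snd.smul
        (measurable_subtype_coe.comp (continuous_stereoPt.measurable.comp measurable_fst)))))
  calc ∫⁻ x, f x
      = ∫⁻ v : EuclideanSpace ℝ (Fin n), ∫⁻ t, f (snocVec v t) := by
        rw [← measurePreserving_snocVec.lintegral_comp hf,
          lintegral_prod _ measurable_f_snoc.aemeasurable]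
    _ = ∫⁻ ξ, (∫⁻ r in Ioi (0 : ℝ), ENNReal.ofReal (r ^ (n - 1)) *
          ∫⁻ t, f (snocVec (r • (ξ : EuclideanSpace ℝ (Fin n))) t)) ∂surf n := by
        rw [lintegral_eq_lintegral_toSphere volume measurable_f_fiber,
          finrank_euclideanSpace_fin, surf]
    _ = ∫⁻ ξ, (∫⁻ ρ, (∫⁻ R in Ioi (0 : ℝ), ENNReal.ofReal (R ^ n) *
          f (R • (stereoPt ρ ξ : EuclideanSpace ℝ (Fin (n + 1))))) ∂stereoRadial n) ∂surf n := by
        refine lintegral_congr fun ξ => ?_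
        rw [lintegral_ray_stereographic hf hn]
        exact (lintegral_stereoRadial (measurable_radial.comp measurable_prodMk_right)).symm
    _ = _ := by
        rw [finrank_euclideanSpace_fin, Nat.add_sub_cancel,
          lintegral_prod_symm _ measurable_radial.aemeasurable]

end StereographicSphere

section AxialKernel

open scoped RealInnerProductSpace

variable {n : ℕ}

theorem surf_real_univ (hn : 1 ≤ n) : (surf n).real univ = sphereArea n := by
  have : Nonempty (Fin n) := ⟨⟨0, hn⟩⟩
  have half_pos : (0 : ℝ) < n / 2 := by positivity
  have := Real.Gamma_pos_of_pos half_pos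
  rw [surf, Measure.toSphere_real_apply_univ, Measure.real, EuclideanSpace.volume_ball,
    ENNReal.ofReal_one, one_pow, one_mul, Fintype.card_fin, finrank_euclideanSpace_fin,
    Real.Gamma_add_one half_pos.ne', ENNReal.toReal_ofReal (by positivity), sphereArea,
    Real.sqrt_eq_rpow, ← Real.rpow_mul_natCast Real.pi_pos.le]
  field_simp

theorem sphereArea_pos (hn : 1 ≤ n) : 0 < sphereArea n := by
  have := Real.Gamma_pos_of_pos (s := (n : ℝ) / 2) (by positivity)
  unfold sphereArea
  positivity

/-- The common kernel `|x_{n+1} - y_{n+1}|^α / |x - y|^n` of the left- and right-sided spherical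
fractional integrals. -/
def axialKernel (α : ℝ) (x y : USphere (n + 1)) : ℝ :=
  |lastCoord x - lastCoord y| ^ α /
    ‖(x : EuclideanSpace ℝ (Fin (n + 1))) - (y : EuclideanSpace ℝ (Fin (n + 1)))‖ ^ n

/-- The kernel of the operators `φ_{j,k} ↦ f^±_{j,k}`, without the factor `c_α`. -/
def abelKernel (n : ℕ) (α : ℝ) (j : ℕ) (a b : ℝ) : ℝ :=
  |a ^ 2 - b ^ 2| ^ (α - 1) / (1 + b ^ 2) ^ (α + (n : ℝ) / 2) * (min a b / max a b) ^ j *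
    (b / max a b) ^ (n - 2) * b

/-- The eigenvalue on spherical harmonics of degree `j` of the zonal operator whose kernel is
`axialKernel α` between the parallels of stereographic radii `a` and `b`. -/
def axialEigenvalue (n : ℕ) (α : ℝ) (j : ℕ) (a b : ℝ) : ℝ :=
  |2 * (a ^ 2 - b ^ 2) / ((1 + a ^ 2) * (1 + b ^ 2))| ^ (α - 1) *
    ((1 + a ^ 2) * (1 + b ^ 2) / (4 * max a b ^ 2)) ^ ((n : ℝ) / 2 - 1) / 2 *
      sphereArea n * (min a b / max a b) ^ j

theorem min_div_max_mem_Ioo {a b : ℝ} (ha : 0 < a) (hb : 0 < b) (hab : a ≠ b) :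
    min a b / max a b ∈ Ioo (0 : ℝ) 1 :=
  ⟨by positivity, (div_lt_one (by positivity)).2 (min_lt_max.2 hab)⟩

theorem max_sq_mul_chordSq {a b : ℝ} (ha : 0 < a) (t : ℝ) :
    max a b ^ 2 * chordSq (min a b / max a b) t = a ^ 2 + b ^ 2 - 2 * a * b * t := by
  have : 0 < max a b := by positivity
  unfold chordSq
  field_simp
  linear_combination (-2 * (1 + t)) * min_mul_max a b +
    (min a b + max a b + a + b) * min_add_max a b

theorem abs_sq_sub_sq {a b : ℝ} (ha : 0 < a) (hb : 0 < b) :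
    |a ^ 2 - b ^ 2| = max a b ^ 2 * (1 - (min a b / max a b) ^ 2) := by
  have : 0 < max a b := by positivity
  field_simp
  rcases le_total a b with h | h
  · rw [max_eq_right h, min_eq_left h, abs_sub_comm, abs_of_nonneg (by nlinarith)]
  · rw [max_eq_left h, min_eq_right h, abs_of_nonneg (by nlinarith)]

theorem axialKernel_stereoPt {a b : ℝ} (ha : 0 < a) (hb : 0 < b) (hab : a ≠ b) (α : ℝ)
    (ξ ζ : USphere n) :
    axialKernel α (stereoPt a ξ) (stereoPt b ζ) =
      |2 * (a ^ 2 - b ^ 2) / ((1 + a ^ 2) * (1 + b ^ 2))| ^ (α - 1) *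
        ((1 + a ^ 2) * (1 + b ^ 2) / (4 * max a b ^ 2)) ^ ((n : ℝ) / 2 - 1) / 2 *
          zonalPoissonKernel (n / 2) (min a b / max a b)
            ⟪(ζ : EuclideanSpace ℝ (Fin n)), ξ⟫ := by
  have ratio_mem := min_div_max_mem_Ioo ha hb hab
  have chordSq_pos : 0 < chordSq (min a b / max a b) ⟪(ζ : EuclideanSpace ℝ (Fin n)), ξ⟫ :=
    chordSq_pos ⟨by linarith [ratio_mem.1], ratio_mem.2⟩ (real_inner_mem_Icc_of_mem_sphere ζ ξ.2)
  set s := min a b / max a b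
  set X := (1 + a ^ 2) * (1 + b ^ 2) / (4 * max a b ^ 2) with X_eq
  set D := chordSq s ⟪(ζ : EuclideanSpace ℝ (Fin n)), ξ⟫
  have : 0 < max a b := by positivity
  have X_pos : 0 < X := by positivity
  have abs_eq : |a ^ 2 - b ^ 2| = max a b ^ 2 * (1 - s ^ 2) := abs_sq_sub_sq ha hb
  have chordSq_eq : max a b ^ 2 * D = _ := max_sq_mul_chordSq ha _
  have height_eq : |2 * (a ^ 2 - b ^ 2) / ((1 + a ^ 2) * (1 + b ^ 2))| = (1 - s ^ 2) / (2 * X) := by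
    rw [abs_div, abs_mul, abs_eq, abs_two, abs_of_pos (by positivity), X_eq]
    field_simp
    ring
  have height_pos : 0 < (1 - s ^ 2) / (2 * X) :=
    div_pos (by nlinarith [ratio_mem.1, ratio_mem.2]) (by positivity)
  have norm_pow : ‖(stereoPt a ξ : EuclideanSpace ℝ (Fin (n + 1))) - stereoPt b ζ‖ ^ n =
      D ^ ((n : ℝ) / 2) / X ^ ((n : ℝ) / 2) := by
    have norm_sq :
        ‖(stereoPt a ξ : EuclideanSpace ℝ (Fin (n + 1))) - stereoPt b ζ‖ ^ 2 = D / X := by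
      rw [norm_stereoPt_sub_sq, real_inner_comm, ← chordSq_eq, X_eq]
      field_simp
    rw [← Real.div_rpow chordSq_pos.le X_pos.le, ← norm_sq, ← Real.rpow_natCast_mul (norm_nonneg _),
      ← Real.rpow_natCast]
    push_cast
    ring_nf
  rw [axialKernel, lastCoord_stereoPt_sub, norm_pow, height_eq, zonalPoissonKernel,
    Real.rpow_neg chordSq_pos.le, Real.rpow_sub_one height_pos.ne', Real.rpow_sub_one X_pos.ne']
  have one_sub_pos : 0 < 1 - s ^ 2 := by nlinarith [ratio_mem.1, ratio_mem.2]
  field_simp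

theorem integral_axialKernel_mul (hn : 2 ≤ n) {a b : ℝ} (ha : 0 < a) (hb : 0 < b) (hab : a ≠ b)
    (α : ℝ) {j : ℕ} {Y : USphere n → ℝ} (hY : Y ∈ sphHarm n j) (ζ : USphere n) :
    ∫ ξ, axialKernel α (stereoPt a ξ) (stereoPt b ζ) * Y ξ ∂surf n =
      axialEigenvalue n α j a b * Y ζ := by
  obtain ⟨p, hp, Y_eq⟩ := exists_isSolidHarmonic_of_mem_sphHarm hY
  have poisson := hp.poissonIntegral_eq ζ (by simpa using hn) (min_div_max_mem_Ioo ha hb hab)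
  rw [poissonIntegral, finrank_euclideanSpace_fin, ← surf, surf_real_univ (by omega)] at poisson
  simp only [axialKernel_stereoPt ha hb hab, Y_eq, mul_assoc]
  rw [integral_const_mul, poisson, axialEigenvalue]
  ring

theorem axialEigenvalue_mul_stereoDensity (hn : 2 ≤ n) {a b : ℝ} (ha : 0 < a) (hb : 0 < b)
    (α : ℝ) (j : ℕ) :
    2 / (Real.Gamma α * sphereArea n) * axialEigenvalue n α j a b * stereoDensity n b =
      cAlpha n α a * abelKernel n α j a b := by
  obtain ⟨m, rfl⟩ := Nat.exists_eq_add_of_le' hn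
  have : 0 < max a b := by positivity
  have sphereArea_pos := sphereArea_pos (n := m + 2) (by omega)
  have half_sub_one : ((m + 2 : ℕ) : ℝ) / 2 - 1 = m / 2 := by push_cast; ring
  have four_rpow : (4 * max a b ^ 2) ^ ((m : ℝ) / 2) = (2 * max a b) ^ m := by
    rw [show 4 * max a b ^ 2 = (2 * max a b) ^ 2 by ring, ← Real.rpow_natCast_mul (by positivity),
      ← Real.rpow_natCast]
    push_cast
    ring_nf
  have two_rpow : (2 : ℝ) ^ (α + 1) = 2 ^ (α - 1) * 4 := by
    rw [show α + 1 = α - 1 + 2 by ring, Real.rpow_add two_pos]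
    norm_num
  have rpow_left : (1 + a ^ 2) ^ (((m + 2 : ℕ) : ℝ) / 2 - α) =
      (1 + a ^ 2) ^ ((m : ℝ) / 2) / (1 + a ^ 2) ^ (α - 1) := by
    rw [← Real.rpow_sub (by positivity)]
    push_cast
    ring_nf
  have rpow_right : (1 + b ^ 2) ^ (α + ((m + 2 : ℕ) : ℝ) / 2) =
      (1 + b ^ 2) ^ (α - 1) * (1 + b ^ 2) ^ (m + 2) / (1 + b ^ 2) ^ ((m : ℝ) / 2) := by
    rw [← Real.rpow_natCast (1 + b ^ 2) (m + 2), ← Real.rpow_add (by positivity),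
      ← Real.rpow_sub (by positivity)]
    push_cast
    ring_nf
  rw [axialEigenvalue, stereoDensity, cAlpha, abelKernel, half_sub_one, abs_div, abs_mul, abs_two,
    abs_of_pos (a := (1 + a ^ 2) * (1 + b ^ 2)) (by positivity),
    Real.div_rpow (by positivity) (by positivity), Real.div_rpow (by positivity) (by positivity),
    Real.mul_rpow (by positivity) (by positivity), Real.mul_rpow (by positivity) (by positivity),
    Real.mul_rpow (by positivity) (by positivity), four_rpow, two_rpow, rpow_left, rpow_right]
  simp only [Nat.add_sub_cancel, show m + 2 - 1 = m + 1 by omega, mul_pow, div_pow, pow_succ]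
  field_simp
  ring

end AxialKernel

section AxialIntegral

open Filter ENNReal

variable {n : ℕ} {I : Set ℝ} {D : Set (USphere (n + 1))}

/-- `D` is, up to the poles, the union of the parallels of `S^n` whose stereographic radii belong
to `I ⊆ (0, ∞)`. -/
structure IsParallelBand (I : Set ℝ) (D : Set (USphere (n + 1))) : Prop where
  measurableSet_radii : MeasurableSet I
  radii_subset : I ⊆ Ioi 0
  measurableSet : MeasurableSet D
  stereoPt_mem_iff : ∀ r > 0, ∀ ξ, stereoPt r ξ ∈ D ↔ r ∈ I

theorem IsParallelBand.surf_restrict_eq_map (hD : IsParallelBand I D) (hn : 1 ≤ n) :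
    (surf (n + 1)).restrict D =
      (((stereoRadial n).restrict I).prod (surf n)).map fun p => stereoPt p.1 p.2 := by
  have ae_pos : ∀ᵐ r ∂stereoRadial n, 0 < r :=
    withDensity_absolutelyContinuous _ _ (ae_restrict_mem measurableSet_Ioi)
  have preimage_eq : (fun p : ℝ × USphere n => stereoPt p.1 p.2) ⁻¹' D
      =ᵐ[(stereoRadial n).prod (surf n)] I ×ˢ univ := by
    refine eventuallyEq_set.2 ?_
    filter_upwards [Measure.quasiMeasurePreserving_fst.ae ae_pos] with p hp
    simpa using hD.stereoPt_mem_iff p.1 hp p.2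
  rw [surf_eq_map_stereoPt hn, Measure.restrict_map continuous_stereoPt.measurable hD.measurableSet,
    Measure.restrict_congr_set preimage_eq, ← Measure.prod_restrict, Measure.restrict_univ]

theorem integrableOn_stereoRadial_iff (hI : MeasurableSet I) (I_sub : I ⊆ Ioi 0) {g : ℝ → ℂ} :
    IntegrableOn g I (stereoRadial n) ↔
      IntegrableOn (fun r => (stereoDensity n r : ℂ) * g r) I := by
  rw [IntegrableOn, stereoRadial, restrict_withDensity hI,
    Measure.restrict_restrict_of_subset I_sub, integrable_withDensity_iff_integrable_smul₀'
      measurable_stereoDensity.ennreal_ofReal.aemeasurable (by simp)]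
  refine integrableOn_congr_fun (fun r hr => ?_) hI
  simp [toReal_ofReal (stereoDensity_nonneg (n := n) (I_sub hr).le)]

theorem setIntegral_stereoRadial (hI : MeasurableSet I) (I_sub : I ⊆ Ioi 0) (g : ℝ → ℂ) :
    ∫ r in I, g r ∂stereoRadial n = ∫ r in I, (stereoDensity n r : ℂ) * g r := by
  rw [stereoRadial, restrict_withDensity hI, Measure.restrict_restrict_of_subset I_sub,
    integral_withDensity_eq_integral_toReal_smul measurable_stereoDensity.ennreal_ofReal (by simp)]
  refine setIntegral_congr_fun hI fun r hr => ?_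
  simp [toReal_ofReal (stereoDensity_nonneg (n := n) (I_sub hr).le)]

theorem IsParallelBand.integrableOn_stereoDensity_mul_integral (hD : IsParallelBand I D)
    (hn : 1 ≤ n) {g : USphere (n + 1) → ℂ} (hg : IntegrableOn g D (surf (n + 1))) :
    IntegrableOn (fun r => (stereoDensity n r : ℂ) * ∫ ξ, g (stereoPt r ξ) ∂surf n) I := by
  rw [IntegrableOn, hD.surf_restrict_eq_map hn] at hg
  exact (integrableOn_stereoRadial_iff hD.measurableSet_radii hD.radii_subset).1
    (hg.comp_measurable continuous_stereoPt.measurable).integral_prod_left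

theorem IsParallelBand.setIntegral_surf (hD : IsParallelBand I D) (hn : 1 ≤ n)
    {g : USphere (n + 1) → ℂ} (hg : IntegrableOn g D (surf (n + 1))) :
    ∫ y in D, g y ∂surf (n + 1) =
      ∫ r in I, (stereoDensity n r : ℂ) * ∫ ξ, g (stereoPt r ξ) ∂surf n := by
  rw [IntegrableOn, hD.surf_restrict_eq_map hn] at hg
  have integrable_comp : Integrable (fun p : ℝ × USphere n => g (stereoPt p.1 p.2))
      (((stereoRadial n).restrict I).prod (surf n)) :=
    hg.comp_measurable continuous_stereoPt.measurable
  rw [hD.surf_restrict_eq_map hn,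
    integral_map continuous_stereoPt.measurable.aemeasurable hg.aestronglyMeasurable,
    integral_prod _ integrable_comp,
    setIntegral_stereoRadial hD.measurableSet_radii hD.radii_subset]

theorem measurable_lastCoord : Measurable (lastCoord : USphere (n + 1) → ℝ) := by
  unfold lastCoord
  fun_prop

theorem measurable_axialKernel (α : ℝ) :
    Measurable fun z : USphere (n + 1) × USphere (n + 1) => axialKernel α z.1 z.2 := by
  have := measurable_lastCoord (n := n)
  unfold axialKernel
  fun_prop

theorem continuous_of_mem_sphHarm {j : ℕ} {Y : USphere n → ℝ} (hY : Y ∈ sphHarm n j) :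
    Continuous Y := by
  obtain ⟨p, hp, Y_eq⟩ := exists_isSolidHarmonic_of_mem_sphHarm hY
  exact (hp.contDiff.continuous.comp continuous_subtype_val).congr fun ξ => (Y_eq ξ).symm

variable {α a : ℝ} {φ : USphere (n + 1) → ℂ}

/-- The integrand `K(x, y) φ(y)` of the spherical fractional integral at the point
`x = stereoPt a ξ` of the parallel of stereographic radius `a`, as a function of `(ξ, y)`. -/
def axialIntegrand (α a : ℝ) (φ : USphere (n + 1) → ℂ) (z : USphere n × USphere (n + 1)) : ℂ :=
  axialKernel α (stereoPt a z.1) z.2 * φ z.2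

theorem aestronglyMeasurable_axialIntegrand (α a : ℝ)
    (hφ : AEStronglyMeasurable φ (surf (n + 1))) :
    AEStronglyMeasurable (axialIntegrand α a φ) ((surf n).prod ((surf (n + 1)).restrict D)) := by
  have measurable_stereo : Measurable fun ξ : USphere n => stereoPt a ξ :=
    (continuous_stereoPt.comp (Continuous.prodMk_right a)).measurable
  have measurable_pair : Measurable fun z : USphere n × USphere (n + 1) =>
      (stereoPt a z.1, z.2) := by
    fun_prop
  have measurable_kernel : Measurable fun z : USphere n × USphere (n + 1) =>
      (axialKernel α (stereoPt a z.1) z.2 : ℂ) :=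
    ((measurable_axialKernel α).comp measurable_pair).complex_ofReal
  have measurable_φ : AEStronglyMeasurable (fun z : USphere n × USphere (n + 1) => φ z.2)
      ((surf n).prod ((surf (n + 1)).restrict D)) := hφ.restrict.comp_snd
  exact measurable_kernel.aestronglyMeasurable.fun_mul measurable_φ

theorem integrable_axialIntegrand (hφ : AEStronglyMeasurable φ (surf (n + 1)))
    (h : ∫⁻ ξ, (∫⁻ y in D, ‖axialIntegrand α a φ (ξ, y)‖ₑ ∂surf (n + 1)) ∂surf n < ⊤) :
    Integrable (axialIntegrand α a φ) ((surf n).prod ((surf (n + 1)).restrict D)) := by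
  have measurable_integrand := aestronglyMeasurable_axialIntegrand (D := D) α a hφ
  refine ⟨measurable_integrand, ?_⟩
  rwa [HasFiniteIntegral, lintegral_prod _ measurable_integrand.enorm]

theorem integrable_axialIntegrand_mul_sphHarm {j : ℕ} {Y : USphere n → ℝ} (hY : Y ∈ sphHarm n j)
    (hK : Integrable (axialIntegrand α a φ) ((surf n).prod ((surf (n + 1)).restrict D))) :
    Integrable (fun z => axialIntegrand α a φ z * Y z.1)
      ((surf n).prod ((surf (n + 1)).restrict D)) := by
  have continuous_Y := continuous_of_mem_sphHarm hY
  obtain ⟨C, hC⟩ := isCompact_univ.exists_bound_of_continuousOn continuous_Y.continuousOn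
  refine hK.mul_bdd (c := C) (by fun_prop) (.of_forall fun z => ?_)
  simpa using hC z.1 (mem_univ _)

theorem integral_axialIntegrand_mul_sphHarm (hn : 2 ≤ n) (ha : 0 < a) {b : ℝ} (hb : 0 < b)
    (hab : a ≠ b) {j : ℕ} {Y : USphere n → ℝ} (hY : Y ∈ sphHarm n j) (ζ : USphere n) :
    ∫ ξ, axialIntegrand α a φ (ξ, stereoPt b ζ) * Y ξ ∂surf n =
      axialEigenvalue n α j a b * (φ (stereoPt b ζ) * Y ζ) := by
  calc _ = ∫ ξ, φ (stereoPt b ζ) *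
        (axialKernel α (stereoPt a ξ) (stereoPt b ζ) * Y ξ : ℝ) ∂surf n := by
        refine integral_congr_ae (.of_forall fun ξ => ?_)
        simp only [axialIntegrand, Complex.ofReal_mul]
        ring
    _ = _ := by
        rw [integral_const_mul, integral_complex_ofReal, integral_axialKernel_mul hn ha hb hab α hY]
        push_cast
        ring

theorem ae_stereoDensity_mul_integral_axialIntegrand (hn : 2 ≤ n) (ha : 0 < a)
    (hD : IsParallelBand I D) (a_notMem : a ∉ I) {j : ℕ} {Y : USphere n → ℝ}
    (hY : Y ∈ sphHarm n j) {u : ℝ → ℂ}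
    (hu : ∀ᵐ r ∂volume.restrict (Ioi 0), u r = ∫ ξ, φ (stereoPt r ξ) * Y ξ ∂surf n) :
    ∀ᵐ b ∂volume.restrict I, ((2 / (Real.Gamma α * sphereArea n) : ℝ) : ℂ) *
      ((stereoDensity n b : ℂ) *
        ∫ ζ, (∫ ξ, axialIntegrand α a φ (ξ, stereoPt b ζ) * Y ξ ∂surf n) ∂surf n) =
      cAlpha n α a * (abelKernel n α j a b * u b) := by
  filter_upwards [ae_restrict_of_ae_restrict_of_subset hD.radii_subset hu,
    ae_restrict_mem hD.measurableSet_radii] with b u_eq hb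
  have b_pos : 0 < b := hD.radii_subset hb
  have a_ne_b : a ≠ b := fun h => a_notMem (h ▸ hb)
  have eigenvalue_eq := congrArg Complex.ofReal
    (axialEigenvalue_mul_stereoDensity hn ha b_pos α j)
  simp only [integral_axialIntegrand_mul_sphHarm hn ha b_pos a_ne_b hY]
  rw [integral_const_mul, ← u_eq]
  push_cast at eigenvalue_eq ⊢
  linear_combination u b * eigenvalue_eq

theorem cAlpha_pos (hα : 0 < α) : 0 < cAlpha n α a := by
  have := Real.Gamma_pos_of_pos hα
  unfold cAlpha
  positivity

theorem IsParallelBand.integrableOn_abelKernel_mul (hD : IsParallelBand I D) (a_notMem : a ∉ I)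
    (hn : 2 ≤ n) (hα : 0 < α) (ha : 0 < a)
    (hK : Integrable (axialIntegrand α a φ) ((surf n).prod ((surf (n + 1)).restrict D)))
    {j : ℕ} {Y : USphere n → ℝ} (hY : Y ∈ sphHarm n j) {u : ℝ → ℂ}
    (hu : ∀ᵐ r ∂volume.restrict (Ioi 0), u r = ∫ ξ, φ (stereoPt r ξ) * Y ξ ∂surf n) :
    IntegrableOn (fun b => (abelKernel n α j a b : ℂ) * u b) I := by
  have integrable_dual := hD.integrableOn_stereoDensity_mul_integral (by omega)
    (integrable_axialIntegrand_mul_sphHarm hY hK).integral_prod_right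
  have ae_eq := ae_stereoDensity_mul_integral_axialIntegrand (α := α) hn ha hD a_notMem hY hu
  have cAlpha_ne_zero : (cAlpha n α a : ℂ) ≠ 0 := by exact_mod_cast (cAlpha_pos hα).ne'
  refine (((integrable_dual.const_mul _).congr ae_eq).const_mul (cAlpha n α a : ℂ)⁻¹).congr ?_
  exact .of_forall fun b => inv_mul_cancel_left₀ cAlpha_ne_zero _

theorem IsParallelBand.integral_axialIntegrand_mul_sphHarm (hD : IsParallelBand I D)
    (a_notMem : a ∉ I) (hn : 2 ≤ n) (ha : 0 < a)
    (hK : Integrable (axialIntegrand α a φ) ((surf n).prod ((surf (n + 1)).restrict D)))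
    {j : ℕ} {Y : USphere n → ℝ} (hY : Y ∈ sphHarm n j) {u : ℝ → ℂ}
    (hu : ∀ᵐ r ∂volume.restrict (Ioi 0), u r = ∫ ξ, φ (stereoPt r ξ) * Y ξ ∂surf n) :
    ∫ ξ, ((2 / (Real.Gamma α * sphereArea n) : ℝ) : ℂ) *
        (∫ y in D, axialIntegrand α a φ (ξ, y) ∂surf (n + 1)) * Y ξ ∂surf n =
      cAlpha n α a * ∫ b in I, (abelKernel n α j a b : ℂ) * u b := by
  have integrable_Y := integrable_axialIntegrand_mul_sphHarm hY hK
  have ae_eq := ae_stereoDensity_mul_integral_axialIntegrand (α := α) hn ha hD a_notMem hY hu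
  rw [← integral_const_mul, ← integral_congr_ae ae_eq, integral_const_mul,
    ← hD.setIntegral_surf (by omega) integrable_Y.integral_prod_right,
    ← integral_integral_swap integrable_Y, ← integral_const_mul]
  refine integral_congr_ae (.of_forall fun ξ => ?_)
  simp only
  rw [integral_mul_const, mul_assoc]

end AxialIntegral

section FractionalMoments

open Filter ENNReal Topology

theorem lintegral_Ioo_rpow_sub_one {α : ℝ} (hα : 0 < α) {s b : ℝ} (hsb : s ≤ b) :
    ∫⁻ t in Ioo s b, ENNReal.ofReal ((t - s) ^ (α - 1)) =
      ENNReal.ofReal α⁻¹ * ENNReal.ofReal ((b - s) ^ α) := by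
  have intervalIntegrable : IntervalIntegrable (fun t => (t - s) ^ (α - 1)) volume s b := by
    simpa using (intervalIntegral.intervalIntegrable_rpow' (a := 0) (b := b - s)
      (by linarith : -1 < α - 1)).comp_sub_right s
  have nonneg : 0 ≤ᵐ[volume.restrict (Ioo s b)] fun t => (t - s) ^ (α - 1) := by
    filter_upwards [ae_restrict_mem measurableSet_Ioo] with t ht
    exact Real.rpow_nonneg (sub_nonneg.2 ht.1.le) _
  rw [← ofReal_integral_eq_lintegral_ofReal
      ((intervalIntegrable_iff_integrableOn_Ioo_of_le hsb).1 intervalIntegrable) nonneg,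
    ← integral_Ioc_eq_integral_Ioo, ← intervalIntegral.integral_of_le hsb,
    intervalIntegral.integral_comp_sub_right (fun t => t ^ (α - 1)) s,
    integral_rpow (.inl (by linarith)), ← ofReal_mul (by positivity)]
  simp [Real.zero_rpow hα.ne', div_eq_inv_mul]

variable {X : Type*} [MeasurableSpace X] {N : Measure X} {h : X → ℝ} {α : ℝ}

theorem measurable_indicator_rpow_sub (hh : Measurable h) (α : ℝ) :
    Measurable fun p : ℝ × X =>
      (Ioi (h p.2)).indicator (fun t => ENNReal.ofReal ((t - h p.2) ^ (α - 1))) p.1 :=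
  Measurable.ite (measurableSet_lt (hh.comp measurable_snd) measurable_fst) (by fun_prop)
    measurable_const

theorem setLIntegral_rpow_sub_eq_lintegral_indicator (hh : Measurable h) (α t : ℝ) :
    ∫⁻ x in {x | h x < t}, ENNReal.ofReal ((t - h x) ^ (α - 1)) ∂N =
      ∫⁻ x, (Ioi (h x)).indicator (fun t => ENNReal.ofReal ((t - h x) ^ (α - 1))) t ∂N := by
  rw [← lintegral_indicator (measurableSet_lt hh measurable_const)]
  rfl

theorem lintegral_setLIntegral_rpow_sub_one [SFinite N] (hh : Measurable h) (hα : 0 < α)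
    (b : ℝ) :
    ∫⁻ t in Iio b, (∫⁻ x in {x | h x < t}, ENNReal.ofReal ((t - h x) ^ (α - 1)) ∂N) =
      ENNReal.ofReal α⁻¹ * ∫⁻ x in {x | h x < b}, ENNReal.ofReal ((b - h x) ^ α) ∂N := by
  simp only [setLIntegral_rpow_sub_eq_lintegral_indicator hh]
  rw [lintegral_lintegral_swap (measurable_indicator_rpow_sub hh α).aemeasurable,
    ← lintegral_const_mul _ (by fun_prop),
    ← lintegral_indicator (measurableSet_lt hh measurable_const)]
  refine lintegral_congr fun x => ?_
  rw [setLIntegral_indicator measurableSet_Ioi, Ioi_inter_Iio]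
  by_cases hx : h x < b
  · rw [lintegral_Ioo_rpow_sub_one hα hx.le, indicator_of_mem (by exact hx)]
  · rw [Ioo_eq_empty hx, indicator_of_notMem (by exact hx)]
    simp

theorem ae_setLIntegral_rpow_sub_one_lt_top [SFinite N] (hh : Measurable h) (hα : 0 < α) {b : ℝ}
    (hb : ∫⁻ x in {x | h x < b}, ENNReal.ofReal ((b - h x) ^ α) ∂N < ⊤) :
    ∀ᵐ t ∂volume.restrict (Iio b),
      ∫⁻ x in {x | h x < t}, ENNReal.ofReal ((t - h x) ^ (α - 1)) ∂N < ⊤ := by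
  have ne_top : ∫⁻ t in Iio b,
      (∫⁻ x in {x | h x < t}, ENNReal.ofReal ((t - h x) ^ (α - 1)) ∂N) ≠ ⊤ := by
    rw [lintegral_setLIntegral_rpow_sub_one hh hα]
    exact (mul_lt_top ofReal_lt_top hb).ne
  refine ae_lt_top' ?_ ne_top
  simp only [setLIntegral_rpow_sub_eq_lintegral_indicator hh]
  exact (measurable_indicator_rpow_sub hh α).lintegral_prod_right'.aemeasurable

theorem ae_setLIntegral_rpow_sub_one_lt_top_of_frequently [SFinite N] (hh : Measurable h)
    (hα : 0 < α) {M : ℝ} (hM : ∃ᶠ b in 𝓝[<] M,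
      ∫⁻ x in {x | h x < b}, ENNReal.ofReal ((b - h x) ^ α) ∂N < ⊤) :
    ∀ᵐ t ∂volume.restrict (Iio M),
      ∫⁻ x in {x | h x < t}, ENNReal.ofReal ((t - h x) ^ (α - 1)) ∂N < ⊤ := by
  obtain ⟨b, b_tendsto, hb⟩ := exists_seq_forall_of_frequently hM
  have Iio_subset : Iio M ⊆ ⋃ k, Iio (b k) := fun t ht =>
    mem_iUnion.2 ((b_tendsto.mono_right nhdsWithin_le_nhds).eventually (lt_mem_nhds ht)).exists
  exact ae_restrict_of_ae_restrict_of_subset Iio_subset <| (ae_restrict_iUnion_iff _ _).2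
    fun k => ae_setLIntegral_rpow_sub_one_lt_top hh hα (hb k)

end FractionalMoments

section Existence

open Filter ENNReal Topology

variable {n : ℕ} {α : ℝ} {φ : USphere (n + 1) → ℂ}

theorem axialKernel_nonneg (α : ℝ) (x y : USphere (n + 1)) : 0 ≤ axialKernel α x y := by
  unfold axialKernel
  positivity

theorem abs_lastCoord_sub_rpow_le (hα : α ≠ 0) (x y : USphere (n + 1)) :
    |lastCoord x - lastCoord y| ^ α ≤ 2 ^ n * axialKernel α x y := by
  rcases eq_or_ne x y with rfl | hxy
  · simpa [Real.zero_rpow hα] using axialKernel_nonneg α x x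
  have dist_pos : 0 < ‖(x : EuclideanSpace ℝ (Fin (n + 1))) - y‖ :=
    norm_pos_iff.2 (sub_ne_zero.2 fun h => hxy (Subtype.ext h))
  have dist_le : ‖(x : EuclideanSpace ℝ (Fin (n + 1))) - y‖ ≤ 2 := by
    refine (norm_sub_le _ _).trans ?_
    rw [norm_eq_of_mem_sphere, norm_eq_of_mem_sphere]
    norm_num
  rw [axialKernel, mul_div_assoc', le_div_iff₀ (by positivity), mul_comm]
  gcongr

theorem axialEigenvalue_zero_le (hn : 2 ≤ n) (α : ℝ) {a b : ℝ} (ha : 0 < a) (hb : 0 < b)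
    (ξ ζ : USphere n) :
    axialEigenvalue n α 0 a b ≤
      ((1 + a ^ 2) * ((1 + a ^ 2) / a ^ 2)) ^ ((n : ℝ) / 2 - 1) * sphereArea n *
        |lastCoord (stereoPt a ξ) - lastCoord (stereoPt b ζ)| ^ (α - 1) := by
  have := sphereArea_pos (n := n) (by omega)
  have : 0 < max a b := by positivity
  have exponent_nonneg : 0 ≤ (n : ℝ) / 2 - 1 := by
    have : (2 : ℝ) ≤ n := by exact_mod_cast hn
    linarith
  have ratio_le : (1 + b ^ 2) / (4 * max a b ^ 2) ≤ (1 + a ^ 2) / a ^ 2 := by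
    have a_le : a ^ 2 ≤ max a b ^ 2 := pow_le_pow_left₀ ha.le (le_max_left a b) 2
    have b_le : b ^ 2 ≤ max a b ^ 2 := pow_le_pow_left₀ hb.le (le_max_right a b) 2
    rw [div_le_div_iff₀ (by positivity) (by positivity)]
    nlinarith [sq_nonneg a, mul_nonneg (sq_nonneg a) (sub_nonneg.2 b_le)]
  have base_rpow_le : ((1 + a ^ 2) * (1 + b ^ 2) / (4 * max a b ^ 2)) ^ ((n : ℝ) / 2 - 1) ≤
      ((1 + a ^ 2) * ((1 + a ^ 2) / a ^ 2)) ^ ((n : ℝ) / 2 - 1) := by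
    rw [mul_div_assoc]
    gcongr
  rw [axialEigenvalue, lastCoord_stereoPt_sub, pow_zero, mul_one]
  set H := |2 * (a ^ 2 - b ^ 2) / ((1 + a ^ 2) * (1 + b ^ 2))| ^ (α - 1)
  have : 0 ≤ H := by positivity
  have : 0 ≤ H * sphereArea n := by positivity
  have lower_nonneg :
      0 ≤ ((1 + a ^ 2) * (1 + b ^ 2) / (4 * max a b ^ 2)) ^ ((n : ℝ) / 2 - 1) := by positivity
  nlinarith

theorem one_mem_sphHarm_zero (n : ℕ) : (1 : USphere n → ℝ) ∈ sphHarm n 0 :=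
  ⟨1, ⟨MvPolynomial.isHomogeneous_one (Fin n) ℝ, by simp [polyLaplacian]⟩,
    funext fun _ => by simp [restrictSphere]⟩

theorem lintegral_axialKernel (hn : 2 ≤ n) (α : ℝ) {a b : ℝ} (ha : 0 < a) (hb : 0 < b)
    (hab : a ≠ b) (ζ : USphere n) :
    ∫⁻ ξ, ENNReal.ofReal (axialKernel α (stereoPt a ξ) (stereoPt b ζ)) ∂surf n =
      ENNReal.ofReal (axialEigenvalue n α 0 a b) := by
  have integral_eq := integral_axialKernel_mul hn ha hb hab α (one_mem_sphHarm_zero n) ζ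
  simp only [Pi.one_apply, mul_one] at integral_eq
  have eigenvalue_pos : 0 < axialEigenvalue n α 0 a b := by
    have := sphereArea_pos (n := n) (by omega)
    have := (min_div_max_mem_Ioo ha hb hab).1
    have : a ^ 2 - b ^ 2 ≠ 0 :=
      sub_ne_zero.2 fun h => hab ((pow_left_inj₀ ha.le hb.le two_ne_zero).1 h)
    unfold axialEigenvalue
    positivity
  rw [← integral_eq, ofReal_integral_eq_lintegral_ofReal _
    (.of_forall fun ξ => axialKernel_nonneg α _ _)]
  exact .of_integral_ne_zero (integral_eq ▸ eigenvalue_pos.ne')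

theorem IsParallelBand.ae_lintegral_axialKernel_le (hn : 2 ≤ n) (α : ℝ) {I : Set ℝ}
    {D : Set (USphere (n + 1))} (hD : IsParallelBand I D) {a : ℝ} (ha : 0 < a)
    (a_notMem : a ∉ I) :
    ∀ᵐ y ∂(surf (n + 1)).restrict D,
      ∫⁻ ξ, ENNReal.ofReal (axialKernel α (stereoPt a ξ) y) ∂surf n ≤
        ENNReal.ofReal (((1 + a ^ 2) * ((1 + a ^ 2) / a ^ 2)) ^ ((n : ℝ) / 2 - 1) *
          sphereArea n * |(a ^ 2 - 1) / (1 + a ^ 2) - lastCoord y| ^ (α - 1)) := by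
  have measurable_stereo : Measurable fun ξ : USphere n => stereoPt a ξ :=
    (continuous_stereoPt.comp (Continuous.prodMk_right a)).measurable
  have measurable_pair : Measurable fun z : USphere (n + 1) × USphere n =>
      (stereoPt a z.2, z.1) := by
    fun_prop
  have measurable_kernel : Measurable fun z : USphere (n + 1) × USphere n =>
      ENNReal.ofReal (axialKernel α (stereoPt a z.2) z.1) :=
    ((measurable_axialKernel α).comp measurable_pair).ennreal_ofReal
  have := measurable_lastCoord (n := n)
  rw [hD.surf_restrict_eq_map (by omega),
    ae_map_iff continuous_stereoPt.measurable.aemeasurable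
      (measurableSet_le measurable_kernel.lintegral_prod_right' (by fun_prop))]
  have ae_mem : ∀ᵐ b ∂(stereoRadial n).restrict I, b ∈ I := ae_restrict_mem hD.measurableSet_radii
  filter_upwards [Measure.quasiMeasurePreserving_fst.ae ae_mem] with p hp
  have b_pos : 0 < p.1 := hD.radii_subset hp
  rw [lintegral_axialKernel hn α ha b_pos (fun h => a_notMem (h ▸ hp)), ← lastCoord_stereoPt a p.2]
  exact ofReal_le_ofReal (axialEigenvalue_zero_le hn α ha b_pos p.2 p.2)

theorem enorm_axialIntegrand (α a : ℝ) (φ : USphere (n + 1) → ℂ) (ξ : USphere n)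
    (y : USphere (n + 1)) :
    ‖axialIntegrand α a φ (ξ, y)‖ₑ =
      ENNReal.ofReal (axialKernel α (stereoPt a ξ) y) * ‖φ y‖ₑ := by
  rw [axialIntegrand, enorm_mul, ← Real.enorm_of_nonneg (axialKernel_nonneg _ _ _)]
  simp [enorm_eq_nnnorm]

theorem IsParallelBand.lintegral_axialIntegrand_lt_top (hn : 2 ≤ n)
    (hφ : AEStronglyMeasurable φ (surf (n + 1))) {I : Set ℝ} {D : Set (USphere (n + 1))}
    (hD : IsParallelBand I D) {a : ℝ} (ha : 0 < a) (a_notMem : a ∉ I)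
    (h : ∫⁻ y in D, ENNReal.ofReal (|(a ^ 2 - 1) / (1 + a ^ 2) - lastCoord y| ^ (α - 1)) *
      ‖φ y‖ₑ ∂surf (n + 1) < ⊤) :
    ∫⁻ ξ, (∫⁻ y in D, ‖axialIntegrand α a φ (ξ, y)‖ₑ ∂surf (n + 1)) ∂surf n < ⊤ := by
  have : 0 < sphereArea n := sphereArea_pos (by omega)
  rw [lintegral_lintegral_swap (aestronglyMeasurable_axialIntegrand α a hφ).enorm]
  simp only [enorm_axialIntegrand]
  set C := ((1 + a ^ 2) * ((1 + a ^ 2) / a ^ 2)) ^ ((n : ℝ) / 2 - 1) * sphereArea n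
  calc _ ≤ ∫⁻ y in D, ENNReal.ofReal C *
        (ENNReal.ofReal (|(a ^ 2 - 1) / (1 + a ^ 2) - lastCoord y| ^ (α - 1)) * ‖φ y‖ₑ)
        ∂surf (n + 1) := by
        refine lintegral_mono_ae ?_
        filter_upwards [hD.ae_lintegral_axialKernel_le hn α ha a_notMem] with y hy
        rw [lintegral_mul_const' _ _ enorm_ne_top, ← mul_assoc, ← ofReal_mul (by positivity)]
        gcongr
    _ = ENNReal.ofReal C * _ := lintegral_const_mul' _ _ ofReal_ne_top
    _ < ⊤ := mul_lt_top ofReal_lt_top h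

end Existence

section SignedSegment

open Filter ENNReal Topology

variable {n : ℕ} {α ε : ℝ} {φ : USphere (n + 1) → ℂ}

theorem continuous_lastCoord : Continuous (lastCoord : USphere (n + 1) → ℝ) := by
  unfold lastCoord
  fun_prop

theorem exists_lastCoord_eq (hn : 1 ≤ n) {t : ℝ} (ht : t ∈ Icc (-1) 1) :
    ∃ x : USphere (n + 1), lastCoord x = t := by
  have : Nonempty (Fin n) := ⟨⟨0, hn⟩⟩
  obtain ⟨ξ⟩ : Nonempty (USphere n) :=
    (NormedSpace.sphere_nonempty.2 zero_le_one).to_subtype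
  refine ⟨polarPt (Real.arccos (-t)) ξ, ?_⟩
  rw [lastCoord_polarPt, Real.cos_arccos (by linarith [ht.2]) (by linarith [ht.1]), neg_neg]

theorem exists_mul_lastCoord_mem_Ioo (hn : 1 ≤ n) (hε : |ε| = 1) {c : ℝ} (hc : c < 1) :
    ∃ x : USphere (n + 1), ε * lastCoord x ∈ Ioo c 1 := by
  obtain ⟨t, ht, t_lt_one⟩ := exists_between (max_lt hc (neg_lt_self one_pos))
  have sq_eq_one : ε * ε = 1 := by rw [← abs_mul_abs_self, hε, one_mul]
  have abs_le_one : |ε * t| ≤ 1 := by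
    rw [abs_mul, hε, one_mul]
    exact abs_le.2 ⟨((le_max_right _ _).trans_lt ht).le, t_lt_one.le⟩
  obtain ⟨x, hx⟩ := exists_lastCoord_eq hn (abs_le.1 abs_le_one)
  refine ⟨x, ?_⟩
  rw [hx, ← mul_assoc, sq_eq_one, one_mul]
  exact ⟨(le_max_left _ _).trans_lt ht, t_lt_one⟩

/-- The spherical segment `{y ∈ S^n : -1 < ε y_{n+1} < c}`, which for `ε = ±1` is the domain of
integration of `S^α_±` at the points `x` with `ε x_{n+1} = c`. -/
def signedSegment (n : ℕ) (ε c : ℝ) : Set (USphere (n + 1)) :=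
  {y | -1 < ε * lastCoord y ∧ ε * lastCoord y < c}

theorem measurableSet_signedSegment (ε c : ℝ) : MeasurableSet (signedSegment n ε c) :=
  (measurable_lastCoord.const_mul ε) measurableSet_Ioo

theorem setLIntegral_withDensity_restrict {X : Type*} [MeasurableSpace X] {μ : Measure X}
    {s t : Set X} (hs : MeasurableSet s) {f g : X → ℝ≥0∞} (hf : AEMeasurable f μ)
    (hg : AEMeasurable g μ) :
    ∫⁻ x in s, g x ∂(μ.restrict t).withDensity f = ∫⁻ x in s ∩ t, g x * f x ∂μ := by
  rw [restrict_withDensity hs, Measure.restrict_restrict hs,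
    lintegral_withDensity_eq_lintegral_mul₀ hf.restrict hg.restrict]
  exact lintegral_congr fun x => mul_comm _ _

theorem setLIntegral_rpow_sub_mul_enorm_lt_top (hα : α ≠ 0) (hε : |ε| = 1) {x : USphere (n + 1)}
    (h : IntegrableOn (fun y => (axialKernel α x y : ℂ) * φ y)
      (signedSegment n ε (ε * lastCoord x)) (surf (n + 1))) :
    ∫⁻ y in signedSegment n ε (ε * lastCoord x),
      ENNReal.ofReal ((ε * lastCoord x - ε * lastCoord y) ^ α) * ‖φ y‖ₑ ∂surf (n + 1) < ⊤ := by
  refine lt_of_le_of_lt ?_ (mul_lt_top (ofReal_lt_top (r := 2 ^ n)) h.hasFiniteIntegral)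
  rw [← lintegral_const_mul' _ _ ofReal_ne_top]
  refine setLIntegral_mono' (measurableSet_signedSegment ε _) fun y hy => ?_
  have sub_eq : ε * lastCoord x - ε * lastCoord y = |lastCoord x - lastCoord y| := by
    rw [← abs_of_pos (sub_pos.2 hy.2), ← mul_sub, abs_mul, hε, one_mul]
  have enorm_kernel : ‖(axialKernel α x y : ℂ)‖ₑ = ENNReal.ofReal (axialKernel α x y) := by
    rw [← Real.enorm_of_nonneg (axialKernel_nonneg α x y)]
    simp [enorm_eq_nnnorm]
  rw [sub_eq, enorm_mul, enorm_kernel, ← mul_assoc, ← ofReal_mul (by positivity)]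
  gcongr
  exact abs_lastCoord_sub_rpow_le hα x y

theorem ae_setLIntegral_signedSegment_rpow_sub_one_lt_top (hn : 1 ≤ n) (hα : 0 < α)
    (hφ : AEStronglyMeasurable φ (surf (n + 1))) (hε : |ε| = 1)
    (h : ∀ᵐ x ∂surf (n + 1), IntegrableOn (fun y => (axialKernel α x y : ℂ) * φ y)
      (signedSegment n ε (ε * lastCoord x)) (surf (n + 1))) :
    ∀ᵐ t ∂volume.restrict (Iio 1), ∫⁻ y in signedSegment n ε t,
      ENNReal.ofReal ((t - ε * lastCoord y) ^ (α - 1)) * ‖φ y‖ₑ ∂surf (n + 1) < ⊤ := by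
  have measurable_height : Measurable fun y : USphere (n + 1) => ε * lastCoord y :=
    measurable_lastCoord.const_mul ε
  have measurable_power (β t : ℝ) : Measurable fun y : USphere (n + 1) =>
      ENNReal.ofReal ((t - ε * lastCoord y) ^ β) := by
    fun_prop
  have segment_eq (t : ℝ) : {y : USphere (n + 1) | ε * lastCoord y < t} ∩
      {y | -1 < ε * lastCoord y} = signedSegment n ε t := inter_comm _ _
  have lintegral_eq (β t : ℝ) : ∫⁻ y in {y | ε * lastCoord y < t},
        ENNReal.ofReal ((t - ε * lastCoord y) ^ β)
        ∂((surf (n + 1)).restrict {y | -1 < ε * lastCoord y}).withDensity (‖φ ·‖ₑ) =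
      ∫⁻ y in signedSegment n ε t,
        ENNReal.ofReal ((t - ε * lastCoord y) ^ β) * ‖φ y‖ₑ ∂surf (n + 1) := by
    rw [setLIntegral_withDensity_restrict (measurableSet_lt measurable_height measurable_const)
      hφ.enorm (measurable_power β t).aemeasurable, segment_eq]
  simp only [← lintegral_eq]
  refine ae_setLIntegral_rpow_sub_one_lt_top_of_frequently measurable_height hα
    ((nhdsLT_basis 1).frequently_iff.2 fun c hc => ?_)
  simp only [lintegral_eq]
  have isOpen_strip : IsOpen {x : USphere (n + 1) | ε * lastCoord x ∈ Ioo c 1} :=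
    isOpen_Ioo.preimage (continuous_lastCoord.const_smul ε)
  have : (surf (n + 1)).IsOpenPosMeasure := by unfold surf; infer_instance
  obtain ⟨x, hx, integrable_x⟩ :=
    (Measure.dense_of_ae h).inter_open_nonempty _ isOpen_strip
      (exists_mul_lastCoord_mem_Ioo hn hε hc)
  exact ⟨_, hx, setLIntegral_rpow_sub_mul_enorm_lt_top hα.ne' hε integrable_x⟩

end SignedSegment

section PolarAngle

theorem ae_restrict_of_subset_image {g : ℝ → ℝ} {s t : Set ℝ} {P : ℝ → Prop}
    (hs : MeasurableSet s) (hg : DifferentiableOn ℝ g t) (hst : s ⊆ g '' t)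
    (h : ∀ᵐ x ∂volume.restrict t, P (g x)) : ∀ᵐ y ∂volume.restrict s, P y := by
  have image_null : volume (g '' ({x | ¬P (g x)} ∩ t)) = 0 :=
    addHaar_image_eq_zero_of_differentiableOn_of_addHaar_eq_zero volume (hg.mono inter_subset_right)
      (nonpos_iff_eq_zero.1 ((Measure.le_restrict_apply _ _).trans h.le))
  rw [ae_restrict_iff' hs]
  refine measure_mono_null (fun y hy => ?_) image_null
  obtain ⟨hys, hPy⟩ := Classical.not_imp.1 hy
  obtain ⟨x, hx, rfl⟩ := hst hys
  exact ⟨x, ⟨hPy, hx⟩, rfl⟩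

theorem ae_restrict_Ioi_of_ae_tan_half {P : ℝ → Prop}
    (h : ∀ᵐ θ ∂volume.restrict (Ioo 0 Real.pi), P (Real.tan (θ / 2))) :
    ∀ᵐ r ∂volume.restrict (Ioi 0), P r := by
  refine ae_restrict_of_subset_image (g := fun θ => Real.tan (θ / 2)) measurableSet_Ioi
    (fun θ hθ => ?_) (fun r hr => ?_) h
  · have differentiableAt_tan : DifferentiableAt ℝ Real.tan (θ / 2) :=
      Real.differentiableAt_tan_of_mem_Ioo
        ⟨by linarith [hθ.1, Real.pi_pos], by linarith [hθ.2]⟩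
    exact (DifferentiableAt.comp (g := Real.tan) (f := (· / 2)) θ differentiableAt_tan
      (differentiableAt_id.div_const 2)).differentiableWithinAt
  · have := Real.arctan_pos.2 hr
    have := Real.arctan_lt_pi_div_two r
    refine ⟨2 * Real.arctan r, ⟨by linarith, by linarith⟩, ?_⟩
    simp [Real.tan_arctan]

theorem ae_restrict_Ioo_pi_of_ae_cos {ε : ℝ} (hε : |ε| = 1) {P : ℝ → Prop}
    (h : ∀ᵐ t ∂volume.restrict (Iio 1), P t) :
    ∀ᵐ θ ∂volume.restrict (Ioo 0 Real.pi), P (ε * -Real.cos θ) := by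
  have sq_eq_one : ε * ε = 1 := by rw [← abs_mul_abs_self, hε, one_mul]
  have abs_mul_eq (t : ℝ) : |ε * -t| = |t| := by rw [abs_mul, abs_neg, hε, one_mul]
  have mul_mul_neg (t : ℝ) : ε * -(ε * -t) = t := by linear_combination t * sq_eq_one
  refine ae_restrict_of_subset_image (g := fun t => Real.arccos (ε * -t)) (t := Ioo (-1) 1)
    measurableSet_Ioo (fun t ht => ?_) (fun θ hθ => ?_) ?_
  · have mem := abs_lt.1 ((abs_mul_eq t).trans_lt (abs_lt.2 ht))
    exact (DifferentiableAt.comp t (Real.differentiableAt_arccos.2 ⟨mem.1.ne', mem.2.ne⟩)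
      (by fun_prop)).differentiableWithinAt
  · have abs_cos_lt : |Real.cos θ| < 1 := abs_lt.2
      ⟨by simpa using Real.cos_lt_cos_of_nonneg_of_le_pi hθ.1.le le_rfl hθ.2,
        by simpa using Real.cos_lt_cos_of_nonneg_of_le_pi le_rfl hθ.2.le hθ.1⟩
    refine ⟨ε * -Real.cos θ, abs_lt.1 ((abs_mul_eq _).trans_lt abs_cos_lt), ?_⟩
    simp only [mul_mul_neg, Real.arccos_cos hθ.1.le hθ.2.le]
  · filter_upwards [ae_restrict_of_ae_restrict_of_subset Ioo_subset_Iio_self h,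
      ae_restrict_mem measurableSet_Ioo] with t P_t ht
    have mem := abs_lt.1 ((abs_mul_eq t).trans_lt (abs_lt.2 ht))
    rwa [Real.cos_arccos mem.1.le mem.2.le, mul_mul_neg]

theorem neg_cos_eq_tan_half {θ : ℝ} (hθ : θ ∈ Ioo 0 Real.pi) :
    -Real.cos θ = (Real.tan (θ / 2) ^ 2 - 1) / (1 + Real.tan (θ / 2) ^ 2) := by
  have neg_one_lt : -1 < Real.cos θ := by
    simpa using Real.cos_lt_cos_of_nonneg_of_le_pi hθ.1.le le_rfl hθ.2
  rw [Real.cos_eq_two_mul_tan_half_div_one_sub_tan_half_sq θ neg_one_lt.ne', ← neg_div, neg_sub]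

theorem tan_half_pos {θ : ℝ} (hθ : θ ∈ Ioo 0 Real.pi) : 0 < Real.tan (θ / 2) :=
  Real.tan_pos_of_pos_of_lt_pi_div_two (by linarith [hθ.1]) (by linarith [hθ.2])

end PolarAngle

section Bands

variable {n : ℕ}

theorem isParallelBand_preimage_lastCoord {S : Set ℝ} (hS : MeasurableSet S) :
    IsParallelBand {r | 0 < r ∧ (r ^ 2 - 1) / (1 + r ^ 2) ∈ S}
      (lastCoord ⁻¹' S : Set (USphere (n + 1))) where
  measurableSet_radii := measurableSet_Ioi.inter <|
    (show Measurable fun r : ℝ => (r ^ 2 - 1) / (1 + r ^ 2) by fun_prop) hS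
  radii_subset _ hr := hr.1
  measurableSet := measurable_lastCoord hS
  stereoPt_mem_iff r hr ξ := by simp [lastCoord_stereoPt, hr]

theorem height_lt_height_iff {r s : ℝ} (hr : 0 < r) (hs : 0 < s) :
    (r ^ 2 - 1) / (1 + r ^ 2) < (s ^ 2 - 1) / (1 + s ^ 2) ↔ r < s := by
  rw [div_lt_div_iff₀ (by positivity) (by positivity),
    ← pow_lt_pow_iff_left₀ hr.le hs.le two_ne_zero]
  constructor <;> intro h <;> linarith

theorem height_mem_Ioo {r : ℝ} (hr : 0 < r) : (r ^ 2 - 1) / (1 + r ^ 2) ∈ Ioo (-1) 1 := by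
  constructor
  · rw [lt_div_iff₀ (by positivity)]
    nlinarith
  · rw [div_lt_one (by positivity)]
    linarith

theorem isParallelBand_segment_S_neg_one {a : ℝ} (ha : 0 < a) :
    IsParallelBand (Ioo 0 a) (segment_S n (-1) ((a ^ 2 - 1) / (1 + a ^ 2))) := by
  have radii_eq : Ioo 0 a =
      {r | 0 < r ∧ (r ^ 2 - 1) / (1 + r ^ 2) ∈ Ioo (-1) ((a ^ 2 - 1) / (1 + a ^ 2))} := by
    ext r
    refine and_congr_right fun hr => ?_
    rw [mem_Ioo, height_lt_height_iff hr ha, and_iff_right (height_mem_Ioo hr).1]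
  rw [radii_eq]
  exact isParallelBand_preimage_lastCoord measurableSet_Ioo

theorem isParallelBand_segment_S_one {a : ℝ} (ha : 0 < a) :
    IsParallelBand (Ioi a) (segment_S n ((a ^ 2 - 1) / (1 + a ^ 2)) 1) := by
  have radii_eq : Ioi a =
      {r | 0 < r ∧ (r ^ 2 - 1) / (1 + r ^ 2) ∈ Ioo ((a ^ 2 - 1) / (1 + a ^ 2)) 1} := by
    ext r
    constructor
    · intro hr
      have r_pos : 0 < r := ha.trans hr
      exact ⟨r_pos, (height_lt_height_iff ha r_pos).2 hr, (height_mem_Ioo r_pos).2⟩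
    · rintro ⟨r_pos, hr, -⟩
      exact (height_lt_height_iff ha r_pos).1 hr
  rw [radii_eq]
  exact isParallelBand_preimage_lastCoord measurableSet_Ioo

end Bands

section Expansion

variable {n : ℕ} {α θ : ℝ} {φ : USphere (n + 1) → ℂ}

theorem kerLeft_eq_axialKernel {c : ℝ} {x y : USphere (n + 1)}
    (hy : y ∈ segment_S n c (lastCoord x)) : kerLeft n α x y = axialKernel α x y := by
  rw [kerLeft, axialKernel, abs_of_pos (sub_pos.2 hy.2)]

theorem kerRight_eq_axialKernel {c : ℝ} {x y : USphere (n + 1)}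
    (hy : y ∈ segment_S n (lastCoord x) c) : kerRight n α x y = axialKernel α x y := by
  rw [kerRight, axialKernel, abs_sub_comm, abs_of_pos (sub_pos.2 hy.1)]

theorem measurableSet_segment_S (a b : ℝ) : MeasurableSet (segment_S n a b) :=
  measurable_lastCoord measurableSet_Ioo

theorem kerLeft_polarPt_mul (hθ : θ ∈ Ioo 0 Real.pi) (ξ : USphere n) {c : ℝ}
    {y : USphere (n + 1)} (hy : y ∈ segment_S n c (lastCoord (polarPt θ ξ))) :
    (kerLeft n α (polarPt θ ξ) y : ℂ) * φ y = axialIntegrand α (Real.tan (θ / 2)) φ (ξ, y) := by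
  rw [kerLeft_eq_axialKernel hy, polarPt_eq_stereoPt hθ, axialIntegrand]

theorem kerRight_polarPt_mul (hθ : θ ∈ Ioo 0 Real.pi) (ξ : USphere n) {c : ℝ}
    {y : USphere (n + 1)} (hy : y ∈ segment_S n (lastCoord (polarPt θ ξ)) c) :
    (kerRight n α (polarPt θ ξ) y : ℂ) * φ y = axialIntegrand α (Real.tan (θ / 2)) φ (ξ, y) := by
  rw [kerRight_eq_axialKernel hy, polarPt_eq_stereoPt hθ, axialIntegrand]

theorem sPlusFiniteAt_iff (hθ : θ ∈ Ioo 0 Real.pi) :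
    SPlusFiniteAt n α φ θ ↔
      ∫⁻ ξ, (∫⁻ y in segment_S n (-1) (-Real.cos θ),
        ‖axialIntegrand α (Real.tan (θ / 2)) φ (ξ, y)‖ₑ ∂surf (n + 1)) ∂surf n < ⊤ := by
  refine iff_of_eq (congrArg (· < ⊤) (lintegral_congr fun ξ => ?_))
  rw [← lastCoord_polarPt θ ξ]
  exact setLIntegral_congr_fun (measurableSet_segment_S _ _) fun y hy =>
    congrArg _ (kerLeft_polarPt_mul hθ ξ hy)

theorem sMinusFiniteAt_iff (hθ : θ ∈ Ioo 0 Real.pi) :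
    SMinusFiniteAt n α φ θ ↔
      ∫⁻ ξ, (∫⁻ y in segment_S n (-Real.cos θ) 1,
        ‖axialIntegrand α (Real.tan (θ / 2)) φ (ξ, y)‖ₑ ∂surf (n + 1)) ∂surf n < ⊤ := by
  refine iff_of_eq (congrArg (· < ⊤) (lintegral_congr fun ξ => ?_))
  rw [← lastCoord_polarPt θ ξ]
  exact setLIntegral_congr_fun (measurableSet_segment_S _ _) fun y hy =>
    congrArg _ (kerRight_polarPt_mul hθ ξ hy)

theorem sPlus_polarPt (hθ : θ ∈ Ioo 0 Real.pi) (ξ : USphere n) :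
    SPlus n α φ (polarPt θ ξ) = ((2 / (Real.Gamma α * sphereArea n) : ℝ) : ℂ) *
      ∫ y in segment_S n (-1) (-Real.cos θ),
        axialIntegrand α (Real.tan (θ / 2)) φ (ξ, y) ∂surf (n + 1) := by
  rw [SPlus, sphFracLeft, ← lastCoord_polarPt θ ξ]
  exact congrArg _ (setIntegral_congr_fun (measurableSet_segment_S _ _) fun y hy =>
    kerLeft_polarPt_mul hθ ξ hy)

theorem sMinus_polarPt (hθ : θ ∈ Ioo 0 Real.pi) (ξ : USphere n) :
    SMinus n α φ (polarPt θ ξ) = ((2 / (Real.Gamma α * sphereArea n) : ℝ) : ℂ) *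
      ∫ y in segment_S n (-Real.cos θ) 1,
        axialIntegrand α (Real.tan (θ / 2)) φ (ξ, y) ∂surf (n + 1) := by
  rw [SMinus, sphFracRight, ← lastCoord_polarPt θ ξ]
  exact congrArg _ (setIntegral_congr_fun (measurableSet_segment_S _ _) fun y hy =>
    kerRight_polarPt_mul hθ ξ hy)

theorem abelKernel_mul_eq_abelPlusIntegrand (hn : 2 ≤ n) (j : ℕ) (u : ℝ → ℂ) {a b : ℝ}
    (hb : b ∈ Ioo 0 a) :
    (abelKernel n α j a b : ℂ) * u b = abelPlusIntegrand n α j u a b := by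
  have sq_sub_pos : 0 < a ^ 2 - b ^ 2 := sub_pos.2 (pow_lt_pow_left₀ hb.2 hb.1.le two_ne_zero)
  rw [abelKernel, abelPlusIntegrand, abs_of_pos sq_sub_pos, min_eq_right hb.2.le,
    max_eq_left hb.2.le, Nat.add_sub_assoc hn, pow_add]
  push_cast
  ring

theorem abelKernel_mul_eq_abelMinusIntegrand (j : ℕ) (u : ℝ → ℂ) {a b : ℝ} (ha : 0 < a)
    (hab : a < b) :
    (abelKernel n α j a b : ℂ) * u b = abelMinusIntegrand n α j u a b := by
  have sq_sub_pos : 0 < b ^ 2 - a ^ 2 := sub_pos.2 (pow_lt_pow_left₀ hab ha.le two_ne_zero)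
  rw [abelKernel, abelMinusIntegrand, abs_sub_comm, abs_of_pos sq_sub_pos, min_eq_left hab.le,
    max_eq_right hab.le, div_self (ha.trans hab).ne', one_pow, mul_one]
  push_cast
  ring

variable {Y : (j : ℕ) → Fin (sphHarmDim n j) → USphere n → ℝ}
  {u : (j : ℕ) → Fin (sphHarmDim n j) → ℝ → ℂ}

theorem ae_coeff_eq_integral_stereoPt (hu : ∀ᵐ θ ∂volume.restrict (Ioo 0 Real.pi),
      IsFourierLaplace n Y (fun ξ => φ (polarPt θ ξ)) fun j k => u j k (Real.tan (θ / 2)))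
    (j : ℕ) (k : Fin (sphHarmDim n j)) :
    ∀ᵐ r ∂volume.restrict (Ioi 0), u j k r = ∫ ξ, φ (stereoPt r ξ) * Y j k ξ ∂surf n := by
  refine ae_restrict_Ioi_of_ae_tan_half ?_
  filter_upwards [hu, ae_restrict_mem measurableSet_Ioo] with θ expansion hθ
  simp only [expansion.2 j k, polarPt_eq_stereoPt hθ]

theorem plusExpansionAt_of_sPlusFiniteAt (hn : 2 ≤ n) (hα : 0 < α)
    (hY : ∀ j k, Y j k ∈ sphHarm n j) (hφ : AEStronglyMeasurable φ (surf (n + 1)))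
    (hu : ∀ᵐ θ ∂volume.restrict (Ioo 0 Real.pi),
      IsFourierLaplace n Y (fun ξ => φ (polarPt θ ξ)) fun j k => u j k (Real.tan (θ / 2)))
    (hθ : θ ∈ Ioo 0 Real.pi) (h : SPlusFiniteAt n α φ θ) : PlusExpansionAt n α Y φ u θ := by
  have a_pos := tan_half_pos hθ
  have band := isParallelBand_segment_S_neg_one (n := n) a_pos
  rw [← neg_cos_eq_tan_half hθ] at band
  have a_notMem : Real.tan (θ / 2) ∉ Ioo 0 (Real.tan (θ / 2)) := right_notMem_Ioo
  have integrable := integrable_axialIntegrand hφ ((sPlusFiniteAt_iff hθ).1 h)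
  have abel_eq (j k) : EqOn (fun b => (abelKernel n α j (Real.tan (θ / 2)) b : ℂ) * u j k b)
      (abelPlusIntegrand n α j (u j k) (Real.tan (θ / 2))) (Ioo 0 (Real.tan (θ / 2))) :=
    fun b hb => abelKernel_mul_eq_abelPlusIntegrand hn j (u j k) hb
  refine ⟨fun j k => ?_, ?_, fun j k => ?_⟩
  · exact (band.integrableOn_abelKernel_mul a_notMem hn hα a_pos integrable (hY j k)
      (ae_coeff_eq_integral_stereoPt hu j k)).congr_fun (abel_eq j k) measurableSet_Ioo
  · simp only [sPlus_polarPt hθ]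
    exact integrable.integral_prod_left.const_mul _
  · simp only [sPlus_polarPt hθ, abelPlus]
    rw [band.integral_axialIntegrand_mul_sphHarm a_notMem hn a_pos integrable (hY j k)
      (ae_coeff_eq_integral_stereoPt hu j k), setIntegral_congr_fun measurableSet_Ioo (abel_eq j k)]

theorem minusExpansionAt_of_sMinusFiniteAt (hn : 2 ≤ n) (hα : 0 < α)
    (hY : ∀ j k, Y j k ∈ sphHarm n j) (hφ : AEStronglyMeasurable φ (surf (n + 1)))
    (hu : ∀ᵐ θ ∂volume.restrict (Ioo 0 Real.pi),
      IsFourierLaplace n Y (fun ξ => φ (polarPt θ ξ)) fun j k => u j k (Real.tan (θ / 2)))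
    (hθ : θ ∈ Ioo 0 Real.pi) (h : SMinusFiniteAt n α φ θ) : MinusExpansionAt n α Y φ u θ := by
  have a_pos := tan_half_pos hθ
  have band := isParallelBand_segment_S_one (n := n) a_pos
  rw [← neg_cos_eq_tan_half hθ] at band
  have a_notMem : Real.tan (θ / 2) ∉ Ioi (Real.tan (θ / 2)) := self_notMem_Ioi
  have integrable := integrable_axialIntegrand hφ ((sMinusFiniteAt_iff hθ).1 h)
  have abel_eq (j k) : EqOn (fun b => (abelKernel n α j (Real.tan (θ / 2)) b : ℂ) * u j k b)
      (abelMinusIntegrand n α j (u j k) (Real.tan (θ / 2))) (Ioi (Real.tan (θ / 2))) :=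
    fun b hb => abelKernel_mul_eq_abelMinusIntegrand j (u j k) a_pos hb
  refine ⟨fun j k => ?_, ?_, fun j k => ?_⟩
  · exact (band.integrableOn_abelKernel_mul a_notMem hn hα a_pos integrable (hY j k)
      (ae_coeff_eq_integral_stereoPt hu j k)).congr_fun (abel_eq j k) measurableSet_Ioi
  · simp only [sMinus_polarPt hθ]
    exact integrable.integral_prod_left.const_mul _
  · simp only [sMinus_polarPt hθ, abelMinus]
    rw [band.integral_axialIntegrand_mul_sphHarm a_notMem hn a_pos integrable (hY j k)
      (ae_coeff_eq_integral_stereoPt hu j k), setIntegral_congr_fun measurableSet_Ioi (abel_eq j k)]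

theorem isParallelBand_signedSegment (ε c : ℝ) :
    IsParallelBand {r | 0 < r ∧ (r ^ 2 - 1) / (1 + r ^ 2) ∈ (ε * ·) ⁻¹' Ioo (-1) c}
      (signedSegment n ε c) :=
  isParallelBand_preimage_lastCoord ((measurable_const_mul ε) measurableSet_Ioo)

theorem ae_lintegral_axialIntegrand_lt_top (hn : 2 ≤ n) (hα : 0 < α)
    (hφ : AEStronglyMeasurable φ (surf (n + 1))) {ε : ℝ} (hε : |ε| = 1)
    (h : ∀ᵐ x ∂surf (n + 1), IntegrableOn (fun y => (axialKernel α x y : ℂ) * φ y)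
      (signedSegment n ε (ε * lastCoord x)) (surf (n + 1))) :
    ∀ᵐ θ ∂volume.restrict (Ioo 0 Real.pi),
      ∫⁻ ξ, (∫⁻ y in signedSegment n ε (ε * -Real.cos θ),
        ‖axialIntegrand α (Real.tan (θ / 2)) φ (ξ, y)‖ₑ ∂surf (n + 1)) ∂surf n < ⊤ := by
  filter_upwards [ae_restrict_mem measurableSet_Ioo, ae_restrict_Ioo_pi_of_ae_cos hε
    (ae_setLIntegral_signedSegment_rpow_sub_one_lt_top (by omega) hα hφ hε h)] with θ hθ moment_lt
  refine (isParallelBand_signedSegment ε _).lintegral_axialIntegrand_lt_top hn hφ (tan_half_pos hθ)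
    (fun mem => mem.2.2.ne (congrArg (ε * ·) (neg_cos_eq_tan_half hθ).symm)) ?_
  rw [← neg_cos_eq_tan_half hθ]
  convert moment_lt using 1
  refine setLIntegral_congr_fun (measurableSet_signedSegment ε _) fun y hy => ?_
  rw [← abs_of_pos (sub_pos.2 hy.2), ← mul_sub, abs_mul, hε, one_mul]

theorem ae_sPlusFiniteAt (hn : 2 ≤ n) (hα : 0 < α) (hφ : AEStronglyMeasurable φ (surf (n + 1)))
    (h : ∀ᵐ x ∂surf (n + 1), SPlusExists n α φ x) :
    ∀ᵐ θ ∂volume.restrict (Ioo 0 Real.pi), SPlusFiniteAt n α φ θ := by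
  have segment_eq (c : ℝ) : signedSegment n 1 c = segment_S n (-1) c := by
    simp [signedSegment, segment_S]
  have integrableOn : ∀ᵐ x ∂surf (n + 1), IntegrableOn (fun y => (axialKernel α x y : ℂ) * φ y)
      (signedSegment n 1 (1 * lastCoord x)) (surf (n + 1)) := by
    filter_upwards [h] with x hx
    rw [segment_eq, one_mul]
    refine hx.congr_fun (fun y hy => ?_) (measurableSet_segment_S _ _)
    simp only [kerLeft_eq_axialKernel hy]
  filter_upwards [ae_restrict_mem measurableSet_Ioo,
    ae_lintegral_axialIntegrand_lt_top hn hα hφ abs_one integrableOn] with θ hθ finite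
  rwa [segment_eq, one_mul, ← sPlusFiniteAt_iff hθ] at finite

theorem ae_sMinusFiniteAt (hn : 2 ≤ n) (hα : 0 < α) (hφ : AEStronglyMeasurable φ (surf (n + 1)))
    (h : ∀ᵐ x ∂surf (n + 1), SMinusExists n α φ x) :
    ∀ᵐ θ ∂volume.restrict (Ioo 0 Real.pi), SMinusFiniteAt n α φ θ := by
  have segment_eq (c : ℝ) : signedSegment n (-1) (-1 * c) = segment_S n c 1 := by
    ext y
    simp [signedSegment, segment_S, and_comm]
  have integrableOn : ∀ᵐ x ∂surf (n + 1), IntegrableOn (fun y => (axialKernel α x y : ℂ) * φ y)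
      (signedSegment n (-1) (-1 * lastCoord x)) (surf (n + 1)) := by
    filter_upwards [h] with x hx
    rw [segment_eq]
    refine hx.congr_fun (fun y hy => ?_) (measurableSet_segment_S _ _)
    simp only [kerRight_eq_axialKernel hy]
  filter_upwards [ae_restrict_mem measurableSet_Ioo,
    ae_lintegral_axialIntegrand_lt_top hn hα hφ (by simp) integrableOn] with θ hθ finite
  rwa [segment_eq, ← sMinusFiniteAt_iff hθ] at finite

end Expansion

end

theorem mainTheorem9_general (n : ℕ) (hn : 2 ≤ n) (α : ℝ) (hα : 0 < α)
    (Y : (j : ℕ) → Fin (sphHarmDim n j) → USphere n → ℝ) (hY : ∀ j k, Y j k ∈ sphHarm n j)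
    (φ : USphere (n + 1) → ℂ) (hφ : AEStronglyMeasurable φ (surf (n + 1)))
    (u : (j : ℕ) → Fin (sphHarmDim n j) → ℝ → ℂ)
    (hu : ∀ᵐ θ ∂(volume.restrict (Ioo 0 Real.pi)),
      IsFourierLaplace n Y (fun ξ => φ (polarPt θ ξ)) (fun j k => u j k (Real.tan (θ / 2)))) :
    ((∀ᵐ x ∂(surf (n + 1)), SPlusExists n α φ x) →
      ∀ᵐ θ ∂(volume.restrict (Ioo 0 Real.pi)), PlusExpansionAt n α Y φ u θ) ∧
    ((∀ᵐ x ∂(surf (n + 1)), SMinusExists n α φ x) →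
      ∀ᵐ θ ∂(volume.restrict (Ioo 0 Real.pi)), MinusExpansionAt n α Y φ u θ) ∧
    (∀ θ ∈ Ioo 0 Real.pi, SPlusFiniteAt n α φ θ → PlusExpansionAt n α Y φ u θ) ∧
    (∀ θ ∈ Ioo 0 Real.pi, SMinusFiniteAt n α φ θ → MinusExpansionAt n α Y φ u θ) := by
  have plus (θ) (hθ : θ ∈ Ioo 0 Real.pi) := plusExpansionAt_of_sPlusFiniteAt hn hα hY hφ hu hθ
  have minus (θ) (hθ : θ ∈ Ioo 0 Real.pi) := minusExpansionAt_of_sMinusFiniteAt hn hα hY hφ hu hθ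
  refine ⟨fun exists_plus => ?_, fun exists_minus => ?_, plus, minus⟩
  · filter_upwards [ae_sPlusFiniteAt hn hα hφ exists_plus, ae_restrict_mem measurableSet_Ioo]
      with θ finite hθ
    exact plus θ hθ finite
  · filter_upwards [ae_sMinusFiniteAt hn hα hφ exists_minus, ae_restrict_mem measurableSet_Ioo]
      with θ finite hθ
    exact minus θ hθ finite

theorem mainTheorem9 (n : ℕ) (hn : 2 ≤ n) (α : ℝ) (hα : 0 < α)
    (Y : (j : ℕ) → Fin (sphHarmDim n j) → USphere n → ℝ) (hY : IsSphHarmBasis n Y)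
    (φ : USphere (n + 1) → ℂ) (hφ : AEStronglyMeasurable φ (surf (n + 1)))
    (u : (j : ℕ) → Fin (sphHarmDim n j) → ℝ → ℂ)
    (hu : ∀ᵐ θ ∂(volume.restrict (Ioo 0 Real.pi)),
      IsFourierLaplace n Y (fun ξ => φ (polarPt θ ξ)) (fun j k => u j k (Real.tan (θ / 2)))) :
    ((∀ᵐ x ∂(surf (n + 1)), SPlusExists n α φ x) →
      ∀ᵐ θ ∂(volume.restrict (Ioo 0 Real.pi)), PlusExpansionAt n α Y φ u θ) ∧
    ((∀ᵐ x ∂(surf (n + 1)), SMinusExists n α φ x) →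
      ∀ᵐ θ ∂(volume.restrict (Ioo 0 Real.pi)), MinusExpansionAt n α Y φ u θ) ∧
    (∀ θ ∈ Ioo 0 Real.pi, SPlusFiniteAt n α φ θ → PlusExpansionAt n α Y φ u θ) ∧
    (∀ θ ∈ Ioo 0 Real.pi, SMinusFiniteAt n α φ θ → MinusExpansionAt n α Y φ u θ) := by
  exact mainTheorem9_general n hn α hα Y hY.mem φ hφ u hu
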